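/- Let $A$ be a finite set, let $d\ge 1$, and let $\mathcal B=\mathcal L(\mathbb C^d)$. Let $\mathcal B^{\mathbb Z}$ be the quasi-local $C^*$-algebra built from $\mathcal B$, i.e. the norm completion of $\bigcup_{\Lambda}\bigotimes_{n\in\Lambda}\mathcal B$ ($\Lambda\subset\mathbb Z$ finite, $a$ identified with $a\otimes\mathbf 1$), and let $T_{out}$ be the shift on it, which moves the observables at the sites $\Lambda$ to the sites $\Lambda+1$. Equip $A^{\mathbb Z}$ with the $\sigma$-algebra $\Sigma_c$ generated by the cylinder sets and the left shift $(T_{in}x)_n=x_{n+1}$, and let $B(A^{\mathbb Z},\Sigma_c)$ be the $C^*$-algebra of bounded measurable functions $A^{\mathbb Z}\to\mathbb C$ with the supremum norm. A *cq-channel* is a map $W:A^{\mathbb Z}\times\mathcal B^{\mathbb Z}\to\mathbb C$ such that $x\mapsto W(x,b)$ is measurable for every $b$ and $W(x,\cdot)$ is a state (a positive linear functional with value $1$ at $\mathbf 1$) for every $x$. It is *stationary* if $W(T_{in}x,b)=W(x,T_{out}b)$ for all $x,b$. For a probability measure $p$ on $(A^{\mathbb Z},\Sigma_c)$, the *joint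 input-output state* $\psi_{p,W}$ is the state on the $C^*$-tensor product $B(A^{\mathbb Z},\Sigma_c)\otimes\mathcal B^{\mathbb Z}$ determined by $$\psi_{p,W}(f\otimes b)=\int f(x)\,W(x,b)\,p(dx).$$ A state on $B(A^{\mathbb Z},\Sigma_c)\otimes\mathcal B^{\mathbb Z}$ is *stationary* if it is invariant under $T_{in}\otimes T_{out}$, where $T_{in}f=f\circ T_{in}$, and *ergodic* if it is an extreme point of the convex set of stationary states. A stationary cq-channel $W$ is *ergodic* if $\psi_{p,W}$ is ergodic for every $T_{in}$-invariant ergodic probability measure $p$. Two stationary cq-channels $W_1,W_2$ are regarded as *equal*, $W_1\sim W_2$, if $\psi_{p,W_1}(f\otimes b)=\psi_{p,W_2}(f\otimes b)$ for all $f\in B(A^{\mathbb Z},\Sigma_c)$, all $b\in\mathcal B^{\mathbb Z}$ and all $T_{in}$-invariant probability measures $p$. A stationary cq-channel $W$ is *extremal* in the convex set of stationary cq-channels if, whenever $W\sim aW_1+(1-a)W_2$ with stationary cq-channels $W_1,W_2$ and $0<a<1$, one has $W_1\sim W_2$. **Theorem.** Let $W:A^{\mathbb Z}\times\mathcal B^{\mathbb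 Z}\to\mathbb C$ be a stationary cq-channel. Then $W$ is extremal in the convex set of stationary cq-channels if and only if $W$ is ergodic. -/

import Mathlib

noncomputable section

namespace CQ

/-! ### The quasi-local algebra over `ℤ` built from `d × d` matrices -/

section QuasiLocal

open scoped Matrix.Norms.L2Operator

/-- The algebra of observables belonging to the finite set of sites `Λ`: the tensor product over
`Λ` of copies of the `d × d` matrices, that is, the matrices indexed by the configurations
`Λ → Fin d`. It carries the operator norm on `ℂ^(d^|Λ|)`, which is the norm of the scope
`Matrix.Norms.L2Operator`. -/
abbrev LocalAlgebra (d : ℕ) (Λ : Finset ℤ) : Type :=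
  Matrix (Λ → Fin d) (Λ → Fin d) ℂ

/-- A configuration on `Λ'` is a configuration on `Λ` together with one on `Λ' \ Λ`. -/
def splitConfig (d : ℕ) {Λ Λ' : Finset ℤ} (h : Λ ≤ Λ') :
    (Λ' → Fin d) ≃ (Λ → Fin d) × ({n : Λ' // (n : ℤ) ∉ Λ} → Fin d) where
  toFun x := (fun n => x ⟨n, h n.2⟩, fun n => x n)
  invFun q := fun n => if hn : (n : ℤ) ∈ Λ then q.1 ⟨n, hn⟩ else q.2 ⟨n, hn⟩
  left_inv x := by
    funext n
    by_cases hn : (n : ℤ) ∈ Λ <;> simp [hn]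
  right_inv q := by
    refine Prod.ext ?_ ?_
    · funext n; simp
    · funext n; simp [n.2]

open scoped Kronecker in
/-- The embedding `a ↦ a ⊗ 1` of the observables on `Λ` into those on `Λ' ⊇ Λ`. -/
def embed (d : ℕ) {Λ Λ' : Finset ℤ} (h : Λ ≤ Λ') :
    LocalAlgebra d Λ →⋆ₐ[ℂ] LocalAlgebra d Λ' where
  toFun a := (a ⊗ₖ (1 : Matrix ({n : Λ' // (n : ℤ) ∉ Λ} → Fin d)
    ({n : Λ' // (n : ℤ) ∉ Λ} → Fin d) ℂ)).submatrix (splitConfig d h) (splitConfig d h)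
  map_one' := by
    rw [Matrix.one_kronecker_one, Matrix.submatrix_one_equiv]
  map_mul' a b := by
    rw [Matrix.submatrix_mul_equiv, ← Matrix.mul_kronecker_mul, one_mul]
  map_zero' := by
    rw [Matrix.zero_kronecker, Matrix.submatrix_zero]; rfl
  map_add' a b := by
    rw [Matrix.add_kronecker, Matrix.submatrix_add]; rfl
  commutes' r := by
    simp only [Algebra.algebraMap_eq_smul_one]
    rw [Matrix.smul_kronecker, Matrix.one_kronecker_one, Matrix.submatrix_smul]
    simp
  map_star' a := by
    simp only [Matrix.star_eq_conjTranspose]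
    rw [Matrix.conjTranspose_submatrix, Matrix.conjTranspose_kronecker, Matrix.conjTranspose_one]

theorem embed_apply (d : ℕ) {Λ Λ' : Finset ℤ} (h : Λ ≤ Λ') (a : LocalAlgebra d Λ)
    (x y : Λ' → Fin d) :
    embed d h a x y = a (fun n => x ⟨n, h n.2⟩) (fun n => y ⟨n, h n.2⟩) *
      if ∀ n : Λ', (n : ℤ) ∉ Λ → x n = y n then 1 else 0 := by
  change a _ _ * (1 : Matrix _ _ ℂ) _ _ = _
  simp only [Matrix.one_apply, funext_iff, Subtype.forall]
  rfl

theorem embed_injective (d : ℕ) [NeZero d] {Λ Λ' : Finset ℤ} (h : Λ ≤ Λ') :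
    Function.Injective (embed d h) := by
  intro a b hab
  have key : ∀ (c : LocalAlgebra d Λ) (u v : Λ → Fin d), c u v =
      embed d h c ((splitConfig d h).symm (u, 0)) ((splitConfig d h).symm (v, 0)) := by
    intro c u v
    change _ = Matrix.submatrix _ _ _ _ _
    simp
  ext u v
  rw [key a, key b, hab]

theorem norm_embed (d : ℕ) [NeZero d] {Λ Λ' : Finset ℤ} (h : Λ ≤ Λ') (a : LocalAlgebra d Λ) :
    ‖embed d h a‖ = ‖a‖ :=
  NonUnitalStarAlgHom.norm_map _ (embed_injective d h) a

instance (d : ℕ) : DirectedSystem (LocalAlgebra d) (fun _ _ h => embed d h) where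
  map_self Λ a := by
    ext x y
    rw [embed_apply, if_pos (fun n hn => absurd n.2 hn), mul_one]
  map_map Λ'' Λ Λ' h h' a := by
    ext x y
    rw [embed_apply, embed_apply, embed_apply, mul_assoc]
    congr 1
    rw [ite_zero_mul_ite_zero, one_mul]
    refine if_congr ⟨fun H n hn => ?_, fun H => ⟨fun n hn => H _ hn,
      fun n hn => H n fun h1 => hn (h h1)⟩⟩ rfl rfl
    by_cases hn' : (n : ℤ) ∈ Λ
    · exact H.1 ⟨n, hn'⟩ hn
    · exact H.2 n hn'

/-- The `*`-algebra of local observables: the union of the algebras `LocalAlgebra d Λ`, in which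
`a` is identified with `a ⊗ 1`. -/
def LocalObservables (d : ℕ) : Type :=
  DirectLimit (LocalAlgebra d) (fun _ _ h => embed d h)

namespace LocalObservables

variable (d : ℕ)

instance : Ring (LocalObservables d) :=
  inferInstanceAs (Ring (DirectLimit (LocalAlgebra d) (fun _ _ h => embed d h)))

instance : Algebra ℂ (LocalObservables d) :=
  inferInstanceAs (Algebra ℂ (DirectLimit (LocalAlgebra d) (fun _ _ h => embed d h)))

instance : StarMul (LocalObservables d) :=
  inferInstanceAs (StarMul (DirectLimit (LocalAlgebra d) (fun _ _ h => embed d h)))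

instance : StarRing (LocalObservables d) where
  star_add := fun a b => StarAddMonoid.star_add
    (R := DirectLimit (LocalAlgebra d) (fun _ _ h => embed d h)) a b

instance : StarModule ℂ (LocalObservables d) :=
  inferInstanceAs (StarModule ℂ (DirectLimit (LocalAlgebra d) (fun _ _ h => embed d h)))

variable {d}

/-- The inclusion of the observables on `Λ` into the local observables. -/
def of (Λ : Finset ℤ) : LocalAlgebra d Λ →⋆ₐ[ℂ] LocalObservables d where
  toFun a := (⟦⟨Λ, a⟩⟧ : DirectLimit (LocalAlgebra d) (fun _ _ h => embed d h))
  map_one' := (DirectLimit.one_def Λ).symm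
  map_mul' a b := (DirectLimit.mul_def (f := fun _ _ h => embed d h) Λ a b).symm
  map_zero' := (DirectLimit.zero_def Λ).symm
  map_add' a b := (DirectLimit.add_def (f := fun _ _ h => embed d h) Λ a b).symm
  commutes' r := (DirectLimit.algebraMap_def Λ r).symm
  map_star' _ := rfl

theorem of_embed {Λ Λ' : Finset ℤ} (h : Λ ≤ Λ') (a : LocalAlgebra d Λ) :
    of Λ' (embed d h a) = of Λ a :=
  (DirectLimit.eq_of_le (f := fun _ _ h => embed d h) ⟨Λ, a⟩ Λ' h).symm

theorem exists_of (a : LocalObservables d) : ∃ Λ a', a = of Λ a' :=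
  DirectLimit.exists_eq_mk (fun _ _ h => embed d h) a

theorem exists_of₂ (a b : LocalObservables d) : ∃ Λ a' b', a = of Λ a' ∧ b = of Λ b' :=
  DirectLimit.exists_eq_mk₂ (fun _ _ h => embed d h) a b

variable [NeZero d]

instance : Norm (LocalObservables d) where
  norm := DirectLimit.lift (fun _ _ h => embed d h) (fun _ a => ‖a‖)
    fun _ _ h a => (norm_embed d h a).symm

theorem norm_of (Λ : Finset ℤ) (a : LocalAlgebra d Λ) : ‖of Λ a‖ = ‖a‖ := rfl

instance : NormedAddCommGroup (LocalObservables d) :=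
  AddGroupNorm.toNormedAddCommGroup
    { toFun := fun a => ‖a‖
      map_zero' := by rw [← map_zero (of ∅), norm_of, norm_zero]
      add_le' := fun a b => by
        obtain ⟨Λ, a, b, rfl, rfl⟩ := exists_of₂ a b
        simpa only [← map_add, norm_of] using norm_add_le a b
      neg' := fun a => by
        obtain ⟨Λ, a, rfl⟩ := exists_of a
        simp only [← map_neg, norm_of, norm_neg]
      eq_zero_of_map_eq_zero' := fun a h => by
        obtain ⟨Λ, a, rfl⟩ := exists_of a
        rw [norm_of, norm_eq_zero] at h
        rw [h, map_zero] }

instance : NormedRing (LocalObservables d) where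
  __ := (inferInstance : Ring (LocalObservables d))
  __ := (inferInstance : NormedAddCommGroup (LocalObservables d))
  norm_mul_le a b := by
    obtain ⟨Λ, a, b, rfl, rfl⟩ := exists_of₂ a b
    rw [← map_mul]
    exact norm_mul_le a b

instance : NormedAlgebra ℂ (LocalObservables d) where
  norm_smul_le r a := by
    obtain ⟨Λ, a, rfl⟩ := exists_of a
    rw [← map_smul]
    exact norm_smul_le r a

instance : CStarRing (LocalObservables d) where
  norm_mul_self_le a := by
    obtain ⟨Λ, a, rfl⟩ := exists_of a
    rw [← map_star, ← map_mul]
    exact CStarRing.norm_mul_self_le a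

end LocalObservables

/-- The quasi-local algebra: the norm completion of the local observables. -/
def QuasiLocal (d : ℕ) [NeZero d] : Type :=
  UniformSpace.Completion (LocalObservables d)

namespace QuasiLocal

open UniformSpace

variable (d : ℕ) [NeZero d]

instance : NormedRing (QuasiLocal d) :=
  inferInstanceAs (NormedRing (Completion (LocalObservables d)))

instance : CompleteSpace (QuasiLocal d) :=
  inferInstanceAs (CompleteSpace (Completion (LocalObservables d)))

instance : Algebra ℂ (QuasiLocal d) :=
  inferInstanceAs (Algebra ℂ (Completion (LocalObservables d)))

instance : NormedAlgebra ℂ (QuasiLocal d) where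
  norm_smul_le r a := norm_smul_le (α := ℂ) (β := Completion (LocalObservables d)) r a

variable {d}

/-- The inclusion of the local observables into the quasi-local algebra. -/
def coe : LocalObservables d → QuasiLocal d :=
  ((↑) : LocalObservables d → Completion (LocalObservables d))

theorem isometry_coe : Isometry (coe (d := d)) := Completion.coe_isometry

theorem denseRange_coe : DenseRange (coe (d := d)) := Completion.denseRange_coe

theorem coe_one : coe (1 : LocalObservables d) = 1 := rfl

theorem coe_add (a b : LocalObservables d) : coe (a + b) = coe a + coe b :=
  Completion.coe_add a b

theorem coe_mul (a b : LocalObservables d) : coe (a * b) = coe a * coe b :=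
  Completion.coe_mul a b

theorem coe_smul (r : ℂ) (a : LocalObservables d) : coe (r • a) = r • coe a :=
  Completion.coe_smul r a

/-- The adjoint extends by continuity from the local observables to the quasi-local algebra. -/
instance : Star (QuasiLocal d) where
  star := Completion.map (star : LocalObservables d → LocalObservables d)

theorem continuous_star' : Continuous (star : QuasiLocal d → QuasiLocal d) :=
  Completion.continuous_map

theorem star_coe (a : LocalObservables d) : star (coe a) = coe (star a) :=
  Completion.map_coe star_isometry.uniformContinuous a

instance : StarRing (QuasiLocal d) where
  star_involutive a := by
    refine denseRange_coe.induction_on (p := fun a => star (star a) = a) a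
      (isClosed_eq (continuous_star'.comp continuous_star') continuous_id) fun a => ?_
    rw [star_coe, star_coe, star_star]
  star_mul a b := by
    refine denseRange_coe.induction_on₂ (p := fun a b => star (a * b) = star b * star a)
      (isClosed_eq (continuous_star'.comp continuous_mul) ((continuous_star'.comp continuous_snd).mul
        (continuous_star'.comp continuous_fst))) (fun a b => ?_) a b
    rw [← coe_mul, star_coe, star_coe, star_coe, ← coe_mul, star_mul]
  star_add a b := by
    refine denseRange_coe.induction_on₂ (p := fun a b => star (a + b) = star a + star b)
      (isClosed_eq (continuous_star'.comp continuous_add) ((continuous_star'.comp continuous_fst).add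
        (continuous_star'.comp continuous_snd))) (fun a b => ?_) a b
    rw [← coe_add, star_coe, star_coe, star_coe, ← coe_add, star_add]

instance : StarModule ℂ (QuasiLocal d) where
  star_smul r a := by
    refine denseRange_coe.induction_on (p := fun a => star (r • a) = star r • star a) a
      (isClosed_eq (continuous_star'.comp (continuous_const_smul r))
        (continuous_star'.const_smul (star r))) fun a => ?_
    rw [← coe_smul, star_coe, star_coe, ← coe_smul, star_smul]

instance : CStarRing (QuasiLocal d) where
  norm_mul_self_le a := by
    refine denseRange_coe.induction_on (p := fun a => ‖a‖ * ‖a‖ ≤ ‖star a * a‖) a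
      (isClosed_le (continuous_norm.mul continuous_norm)
        (continuous_norm.comp (continuous_star'.mul continuous_id))) fun a => ?_
    have h : ∀ b : LocalObservables d, ‖coe b‖ = ‖b‖ := Completion.norm_coe
    rw [star_coe, ← coe_mul, h, h]
    exact CStarRing.norm_mul_self_le a

instance : CStarAlgebra (QuasiLocal d) where

instance : NormOneClass (QuasiLocal d) where
  norm_one := by
    rw [← coe_one, ← map_one (LocalObservables.of (d := d) ∅)]
    exact (Completion.norm_coe _).trans (norm_one (α := LocalAlgebra d ∅))

end QuasiLocal

/-! ### The shift -/

/-- The shift of configurations, `(x_{n+1})_{n ∈ Λ}` for a configuration `x` on `Λ + 1`. -/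
def shiftConfig (d : ℕ) (Λ : Finset ℤ) :
    (Λ.map (addRightEmbedding (1 : ℤ)) → Fin d) ≃ (Λ → Fin d) :=
  Equiv.arrowCongr (Λ.equivMap (addRightEmbedding (1 : ℤ))).symm (Equiv.refl _)

theorem shiftConfig_apply (d : ℕ) (Λ : Finset ℤ)
    (x : Λ.map (addRightEmbedding (1 : ℤ)) → Fin d) (n : Λ) :
    shiftConfig d Λ x n = x ⟨n + 1, Finset.mem_map_of_mem (addRightEmbedding (1 : ℤ)) n.2⟩ :=
  rfl

/-- The shift on observables over `Λ`: the observable `a` is moved from the sites in `Λ` to the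
sites in `Λ + 1`. -/
def localShift (d : ℕ) (Λ : Finset ℤ) :
    LocalAlgebra d Λ →⋆ₐ[ℂ] LocalAlgebra d (Λ.map (addRightEmbedding (1 : ℤ))) where
  toFun a := a.submatrix (shiftConfig d Λ) (shiftConfig d Λ)
  map_one' := Matrix.submatrix_one_equiv _
  map_mul' a b := (Matrix.submatrix_mul_equiv a b _ _ _).symm
  map_zero' := rfl
  map_add' _ _ := rfl
  commutes' r := by
    simp only [Algebra.algebraMap_eq_smul_one]
    rw [Matrix.submatrix_smul]
    simp
  map_star' _ := rfl

theorem localShift_injective (d : ℕ) (Λ : Finset ℤ) : Function.Injective (localShift d Λ) :=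
  fun _ _ h => (Matrix.reindex (shiftConfig d Λ).symm (shiftConfig d Λ).symm).injective h

theorem localShift_embed (d : ℕ) {Λ Λ' : Finset ℤ} (h : Λ ≤ Λ') (a : LocalAlgebra d Λ) :
    localShift d Λ' (embed d h a) =
      embed d (Finset.map_subset_map.2 h) (localShift d Λ a) := by
  ext x y
  rw [embed_apply]
  change embed d h a _ _ = a _ _ * _
  rw [embed_apply]
  congr 1
  refine if_congr ⟨fun H => ?_, fun H n hn => ?_⟩ rfl rfl
  · rintro ⟨m, hm⟩ hn
    obtain ⟨n, hn', rfl⟩ := Finset.mem_map.1 hm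
    exact H ⟨n, hn'⟩ fun h1 => hn (Finset.mem_map_of_mem _ h1)
  · refine H ⟨n + 1, _⟩ fun h1 => hn ?_
    exact (Finset.mem_map' (addRightEmbedding (1 : ℤ))).1 h1

namespace LocalObservables

variable {d : ℕ}

/-- The shift on the local observables, as a function. -/
def shiftFun : LocalObservables d → LocalObservables d :=
  DirectLimit.lift (fun _ _ h => embed d h) (fun Λ a => of _ (localShift d Λ a))
    fun Λ Λ' h a => by rw [localShift_embed, of_embed]

theorem shiftFun_of (Λ : Finset ℤ) (a : LocalAlgebra d Λ) :
    shiftFun (of Λ a) = of _ (localShift d Λ a) := rfl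

/-- The shift on the local observables. -/
def shift : LocalObservables d →⋆ₐ[ℂ] LocalObservables d where
  toFun := shiftFun
  map_one' := by
    rw [← map_one (of ∅), shiftFun_of, map_one, map_one, map_one]
  map_mul' a b := by
    obtain ⟨Λ, a, b, rfl, rfl⟩ := exists_of₂ a b
    rw [← map_mul, shiftFun_of, shiftFun_of, shiftFun_of, map_mul, map_mul]
  map_zero' := by
    rw [← map_zero (of ∅), shiftFun_of, map_zero, map_zero, map_zero]
  map_add' a b := by
    obtain ⟨Λ, a, b, rfl, rfl⟩ := exists_of₂ a b
    rw [← map_add, shiftFun_of, shiftFun_of, shiftFun_of, map_add, map_add]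
  commutes' r := by
    rw [← AlgHomClass.commutes (of ∅) r, shiftFun_of, AlgHomClass.commutes (localShift d ∅) r,
      AlgHomClass.commutes (of _) r, AlgHomClass.commutes (of _) r]
  map_star' a := by
    obtain ⟨Λ, a, rfl⟩ := exists_of a
    rw [← map_star, shiftFun_of, shiftFun_of, map_star, map_star]

theorem shift_of (Λ : Finset ℤ) (a : LocalAlgebra d Λ) :
    shift (of Λ a) = of _ (localShift d Λ a) := rfl

theorem norm_shift [NeZero d] (a : LocalObservables d) : ‖shift a‖ = ‖a‖ := by
  obtain ⟨Λ, a, rfl⟩ := exists_of a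
  rw [shift_of]
  exact NonUnitalStarAlgHom.norm_map _ (localShift_injective d Λ) a

theorem isometry_shift [NeZero d] : Isometry (shift : LocalObservables d → LocalObservables d) :=
  AddMonoidHomClass.isometry_of_norm _ norm_shift

end LocalObservables

namespace QuasiLocal

open UniformSpace

variable (d : ℕ) [NeZero d]

/-- The shift on the quasi-local algebra, as a function: the continuous extension of the shift on
the local observables. -/
def shiftFun : QuasiLocal d → QuasiLocal d :=
  Completion.map (LocalObservables.shift : LocalObservables d → LocalObservables d)

variable {d}

theorem continuous_shiftFun : Continuous (shiftFun d) := Completion.continuous_map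

theorem shiftFun_coe (a : LocalObservables d) :
    shiftFun d (coe a) = coe (LocalObservables.shift a) :=
  Completion.map_coe LocalObservables.isometry_shift.uniformContinuous a

theorem coe_algebraMap (r : ℂ) :
    coe (algebraMap ℂ (LocalObservables d) r) = algebraMap ℂ (QuasiLocal d) r := by
  rw [Algebra.algebraMap_eq_smul_one, Algebra.algebraMap_eq_smul_one, coe_smul, coe_one]

variable (d)

/-- The shift `T_out` on the quasi-local algebra, a `*`-endomorphism that moves the observables
on `Λ` to `Λ + 1`. -/
def shift : QuasiLocal d →⋆ₐ[ℂ] QuasiLocal d where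
  toFun := shiftFun d
  map_one' := by
    rw [← coe_one, shiftFun_coe, map_one]
  map_mul' a b := by
    refine denseRange_coe.induction_on₂ (p := fun a b => shiftFun d (a * b) = shiftFun d a * shiftFun d b)
      (isClosed_eq (continuous_shiftFun.comp continuous_mul)
        ((continuous_shiftFun.comp continuous_fst).mul (continuous_shiftFun.comp continuous_snd)))
      (fun a b => ?_) a b
    rw [← coe_mul, shiftFun_coe, shiftFun_coe, shiftFun_coe, ← coe_mul, map_mul]
  map_zero' := by
    rw [← map_zero (algebraMap ℂ (QuasiLocal d)), ← coe_algebraMap, shiftFun_coe,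
      AlgHomClass.commutes]
  map_add' a b := by
    refine denseRange_coe.induction_on₂ (p := fun a b => shiftFun d (a + b) = shiftFun d a + shiftFun d b)
      (isClosed_eq (continuous_shiftFun.comp continuous_add)
        ((continuous_shiftFun.comp continuous_fst).add (continuous_shiftFun.comp continuous_snd)))
      (fun a b => ?_) a b
    rw [← coe_add, shiftFun_coe, shiftFun_coe, shiftFun_coe, ← coe_add, map_add]
  commutes' r := by
    rw [← coe_algebraMap, shiftFun_coe, AlgHomClass.commutes]
  map_star' a := by
    refine denseRange_coe.induction_on (p := fun a => shiftFun d (star a) = star (shiftFun d a)) a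
      (isClosed_eq (continuous_shiftFun.comp continuous_star')
        (continuous_star'.comp continuous_shiftFun)) fun a => ?_
    rw [star_coe, shiftFun_coe, shiftFun_coe, star_coe, map_star]

end QuasiLocal

end QuasiLocal

/-! ### States -/

section States

variable (𝒜 : Type*) [CStarAlgebra 𝒜]

open scoped ComplexOrder in
/-- The states of a unital C*-algebra: the positive normalized linear functionals. -/
def states : Set (𝒜 →ₗ[ℂ] ℂ) :=
  {ψ | (∀ a, 0 ≤ ψ (star a * a)) ∧ ψ 1 = 1}

variable {𝒜}

/-- The states that are invariant under `T`. -/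
def stationaryStates (T : 𝒜 →⋆ₐ[ℂ] 𝒜) : Set (𝒜 →ₗ[ℂ] ℂ) :=
  {ψ | ψ ∈ states 𝒜 ∧ ∀ a, ψ (T a) = ψ a}

/-- A functional is an ergodic state if it is an extreme point of the convex set of stationary
states. -/
def IsErgodicState (T : 𝒜 →⋆ₐ[ℂ] 𝒜) (ψ : 𝒜 →ₗ[ℂ] ℂ) : Prop :=
  ψ ∈ (stationaryStates T).extremePoints ℝ

open scoped ComplexOrder in
theorem norm_state_le {ψ : 𝒜 →ₗ[ℂ] ℂ} (hψ : ψ ∈ states 𝒜) (a : 𝒜) : ‖ψ a‖ ≤ 4 * ‖a‖ := by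
  let := CStarAlgebra.spectralOrder 𝒜
  let := CStarAlgebra.spectralOrderedRing 𝒜
  have hpos : ∀ b : 𝒜, 0 ≤ b → 0 ≤ ψ b := fun b hb => by
    obtain ⟨c, rfl⟩ := CStarAlgebra.nonneg_iff_eq_star_mul_self.1 hb
    exact hψ.1 c
  have hb : ∀ b : 𝒜, 0 ≤ b → ‖ψ b‖ ≤ ‖b‖ := fun b hb => by
    have h1 : 0 ≤ ψ (algebraMap ℂ 𝒜 (‖b‖ : ℂ) - b) :=
      hpos _ (sub_nonneg.2 ((IsSelfAdjoint.of_nonneg hb).le_algebraMap_norm_self.trans_eq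
        (IsScalarTower.algebraMap_apply ℝ ℂ 𝒜 ‖b‖)))
    rw [map_sub, Algebra.algebraMap_eq_smul_one, map_smul, hψ.2, smul_eq_mul, mul_one,
      sub_nonneg] at h1
    have h2 := CStarAlgebra.norm_le_norm_of_nonneg_of_le (hpos b hb) h1
    simpa using h2
  obtain ⟨y, hy0, hy1, hy⟩ := CStarAlgebra.exists_sum_four_nonneg a
  conv_lhs => rw [hy]
  rw [map_sum]
  refine (norm_sum_le _ _).trans ((Finset.sum_le_sum (g := fun _ => ‖a‖) fun i _ => ?_).trans ?_)
  · rw [map_smul, norm_smul]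
    simpa using (hb _ (hy0 i)).trans (hy1 i)
  · simp

end States

/-! ### The tensor product of the bounded measurable functions with a C*-algebra -/

section Tensor

open scoped ENNReal TensorProduct

variable (X : Type*) (𝔅 : Type*) [CStarAlgebra 𝔅] [NormOneClass 𝔅]

/-- The C*-algebra of all bounded functions `X → 𝔅`, with the supremum norm. -/
abbrev BoundedFun : Type _ := lp (fun _ : X => 𝔅) ∞

instance : CStarAlgebra (BoundedFun X 𝔅) where

variable {X 𝔅} in
/-- A bounded function as an element of `BoundedFun X 𝔅`. -/
def BoundedFun.mk (F : X → 𝔅) (C : ℝ) (hF : ∀ x, ‖F x‖ ≤ C) : BoundedFun X 𝔅 :=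
  ⟨F, memℓp_infty ⟨C, by rintro _ ⟨x, rfl⟩; exact hF x⟩⟩

/-- The commutative C*-algebra of the bounded measurable functions `X → ℂ`. -/
def BddMeas [MeasurableSpace X] : StarSubalgebra ℂ (BoundedFun X ℂ) where
  carrier := {f | Measurable (f : X → ℂ)}
  mul_mem' hf hg := Measurable.mul hf hg
  add_mem' hf hg := Measurable.add hf hg
  algebraMap_mem' r := measurable_const (a := r)
  star_mem' hf := Complex.continuous_conj.measurable.comp hf

variable {X 𝔅}

/-- The scalar function `f` as a function with values in `𝔅`. -/
def scalarHom : BoundedFun X ℂ →⋆ₐ[ℂ] BoundedFun X 𝔅 where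
  toFun f := BoundedFun.mk (fun x => algebraMap ℂ 𝔅 (f x)) ‖f‖ fun x => by
    rw [norm_algebraMap']
    exact lp.norm_apply_le_norm ENNReal.top_ne_zero f x
  map_one' := by ext x; exact map_one _
  map_mul' f g := by ext x; exact map_mul _ _ _
  map_zero' := by ext x; exact map_zero _
  map_add' f g := by ext x; exact map_add _ _ _
  commutes' r := rfl
  map_star' f := by ext x; exact algebraMap_star_comm _

/-- The element `b` as a constant function. -/
def constHom : 𝔅 →⋆ₐ[ℂ] BoundedFun X 𝔅 where
  toFun b := BoundedFun.mk (fun _ => b) ‖b‖ fun _ => le_rfl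
  map_one' := rfl
  map_mul' _ _ := rfl
  map_zero' := rfl
  map_add' _ _ := rfl
  commutes' _ := rfl
  map_star' _ := rfl

variable [MeasurableSpace X]

variable (X 𝔅) in
/-- The homomorphism `f ⊗ b ↦ (x ↦ f x • b)`, without its compatibility with the adjoint. -/
def tensorAlgHom : BddMeas X ⊗[ℂ] 𝔅 →ₐ[ℂ] BoundedFun X 𝔅 :=
  Algebra.TensorProduct.lift (((scalarHom (𝔅 := 𝔅)).comp (BddMeas X).subtype).toAlgHom)
    (constHom (X := X) (𝔅 := 𝔅)).toAlgHom fun f b => by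
      ext x
      exact Algebra.commutes ((f : BoundedFun X ℂ) x) b

theorem tensorAlgHom_tmul (f : BddMeas X) (b : 𝔅) :
    tensorAlgHom X 𝔅 (f ⊗ₜ b) = scalarHom (f : BoundedFun X ℂ) * constHom b :=
  Algebra.TensorProduct.lift_tmul _ _ _ _ _

theorem tensorAlgHom_tmul_apply (f : BddMeas X) (b : 𝔅) (x : X) :
    tensorAlgHom X 𝔅 (f ⊗ₜ b) x = (f : BoundedFun X ℂ) x • b := by
  rw [tensorAlgHom_tmul]
  exact (Algebra.smul_def _ _).symm

variable (X 𝔅) in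
/-- The algebraic tensor product of the bounded measurable functions on `X` with `𝔅`, represented
by functions `X → 𝔅`: the tensor `f ⊗ b` is the function `x ↦ f x • b`. -/
def tensorHom : BddMeas X ⊗[ℂ] 𝔅 →⋆ₐ[ℂ] BoundedFun X 𝔅 where
  __ := tensorAlgHom X 𝔅
  map_star' t := by
    change tensorAlgHom X 𝔅 (star t) = star (tensorAlgHom X 𝔅 t)
    induction t using TensorProduct.induction_on with
    | zero => rw [star_zero, map_zero, star_zero]
    | add s t hs ht => rw [star_add, map_add, map_add, star_add, hs, ht]
    | tmul f b =>
      rw [TensorProduct.star_tmul]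
      ext x
      rw [tensorAlgHom_tmul_apply]
      change _ = star (tensorAlgHom X 𝔅 (f ⊗ₜ b) x)
      rw [tensorAlgHom_tmul_apply, star_smul]
      rfl

theorem tensorHom_tmul (f : BddMeas X) (b : 𝔅) (x : X) :
    tensorHom X 𝔅 (f ⊗ₜ b) x = (f : BoundedFun X ℂ) x • b :=
  tensorAlgHom_tmul_apply f b x

/-- The algebraic tensor product is faithfully represented, so that the supremum norm is a C*-norm
on it (the only one, as one of the factors is commutative). -/
theorem tensorHom_injective : Function.Injective (tensorHom X 𝔅) := by
  rw [injective_iff_map_eq_zero]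
  classical
  intro t ht
  set v := Module.Basis.ofVectorSpace ℂ 𝔅
  obtain ⟨m, rfl⟩ := (TensorProduct.equivFinsuppOfBasisRight (M := BddMeas X) v).symm.surjective t
  rw [TensorProduct.equivFinsuppOfBasisRight_symm_apply] at ht
  suffices m = 0 by rw [this, map_zero]
  ext i x
  have hx : ∑ j ∈ m.support, (m j : BoundedFun X ℂ) x • v j = 0 := by
    have h2 := congrArg (fun F : BoundedFun X 𝔅 => F x) ht
    rw [Finsupp.sum, map_sum] at h2
    simp only [lp.coeFn_sum] at h2
    refine Eq.trans ?_ h2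
    refine Eq.trans ?_ (Finset.sum_apply x m.support
      (fun j => (tensorHom X 𝔅 (m j ⊗ₜ v j) : X → 𝔅))).symm
    exact Finset.sum_congr rfl fun j _ => (tensorHom_tmul _ _ x).symm
  by_cases hi : i ∈ m.support
  · exact linearIndependent_iff'.1 v.linearIndependent _ _ hx i hi
  · rw [Finsupp.notMem_support_iff.1 hi]
    rfl

variable (X 𝔅) in
/-- The C*-tensor product of the bounded measurable functions on `X` with `𝔅`: the norm closure of
the (faithfully represented) algebraic tensor product. -/
def tensorAlgebra : StarSubalgebra ℂ (BoundedFun X 𝔅) :=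
  (tensorHom X 𝔅).range.topologicalClosure

instance : CStarAlgebra (tensorAlgebra X 𝔅) :=
  StarSubalgebra.cstarAlgebra _
    (h_closed := StarSubalgebra.isClosed_topologicalClosure (tensorHom X 𝔅).range)

/-- The elementary tensor `f ⊗ b` in the C*-tensor product. -/
def elemTensor (f : BddMeas X) (b : 𝔅) : tensorAlgebra X 𝔅 :=
  ⟨tensorHom X 𝔅 (f ⊗ₜ b), StarSubalgebra.le_topologicalClosure _ ⟨f ⊗ₜ b, rfl⟩⟩

/-- The function `x ↦ T (F (τ x))`. -/
def boundedShift (τ : X → X) (T : 𝔅 →⋆ₐ[ℂ] 𝔅) : BoundedFun X 𝔅 →⋆ₐ[ℂ] BoundedFun X 𝔅 where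
  toFun F := BoundedFun.mk (fun x => T (F (τ x))) ‖F‖ fun x =>
    (NonUnitalStarAlgHom.norm_apply_le T _).trans
      (lp.norm_apply_le_norm ENNReal.top_ne_zero F (τ x))
  map_one' := by ext x; exact map_one T
  map_mul' F G := by ext x; exact map_mul T _ _
  map_zero' := by ext x; exact map_zero T
  map_add' F G := by ext x; exact map_add T _ _
  commutes' r := by ext x; exact AlgHomClass.commutes T r
  map_star' F := by ext x; exact map_star T _

theorem boundedShift_mem {τ : X → X} (hτ : Measurable τ) (T : 𝔅 →⋆ₐ[ℂ] 𝔅) {F : BoundedFun X 𝔅}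
    (hF : F ∈ tensorAlgebra X 𝔅) : boundedShift τ T F ∈ tensorAlgebra X 𝔅 := by
  have key : ∀ t, boundedShift τ T (tensorHom X 𝔅 t) ∈ (tensorHom X 𝔅).range := fun t => by
    induction t using TensorProduct.induction_on with
    | zero => rw [map_zero, map_zero]; exact zero_mem _
    | add s t hs ht => rw [map_add, map_add]; exact add_mem hs ht
    | tmul f b =>
      refine ⟨(⟨BoundedFun.mk (fun x => (f : BoundedFun X ℂ) (τ x)) ‖f‖ fun x =>
        lp.norm_apply_le_norm ENNReal.top_ne_zero (f : BoundedFun X ℂ) (τ x),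
        Measurable.comp (g := (f : BoundedFun X ℂ)) f.2 hτ⟩ : BddMeas X) ⊗ₜ T b, ?_⟩
      ext x
      refine (tensorHom_tmul _ _ x).trans ?_
      change _ = T (tensorHom X 𝔅 (f ⊗ₜ b) (τ x))
      rw [tensorHom_tmul, map_smul]
      rfl
  refine map_mem_closure (AddMonoidHomClass.continuous_of_bound (boundedShift τ T) 1 fun F => by
    simpa using NonUnitalStarAlgHom.norm_apply_le (boundedShift τ T) F) hF ?_
  rintro _ ⟨t, rfl⟩
  exact key t

/-- The endomorphism of the C*-tensor product given by `f ⊗ b ↦ (f ∘ τ) ⊗ T b`. -/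
def tensorShift {τ : X → X} (hτ : Measurable τ) (T : 𝔅 →⋆ₐ[ℂ] 𝔅) :
    tensorAlgebra X 𝔅 →⋆ₐ[ℂ] tensorAlgebra X 𝔅 :=
  ((boundedShift τ T).comp (tensorAlgebra X 𝔅).subtype).codRestrict (tensorAlgebra X 𝔅)
    fun F => boundedShift_mem hτ T F.2

end Tensor

/-! ### Classical-quantum channels -/

section Channels

open MeasureTheory
open scoped TensorProduct

/-- A cq-channel with input alphabet `A` and output algebra the quasi-local algebra over the
`d × d` matrices. -/
structure CQChannel (A : Type*) [MeasurableSpace A] (d : ℕ) [NeZero d] where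
  toFun : (ℤ → A) → QuasiLocal d →ₗ[ℂ] ℂ
  measurable_toFun : ∀ b, Measurable fun x => toFun x b
  toFun_mem_states : ∀ x, toFun x ∈ states (QuasiLocal d)

/-- The left shift `T_in` on the doubly infinite sequences. -/
def shiftIn (A : Type*) (x : ℤ → A) : ℤ → A := fun n => x (n + 1)

theorem measurable_shiftIn (A : Type*) [MeasurableSpace A] : Measurable (shiftIn A) :=
  measurable_pi_lambda _ fun n => measurable_pi_apply (n + 1)

/-- The C*-tensor product of the bounded measurable functions of the input with the output
algebra. -/
abbrev JointAlgebra (A : Type*) [MeasurableSpace A] (d : ℕ) [NeZero d] : Type _ :=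
  tensorAlgebra (ℤ → A) (QuasiLocal d)

/-- The shift `T_in ⊗ T_out` on the joint input-output algebra. -/
def jointShift (A : Type*) [MeasurableSpace A] (d : ℕ) [NeZero d] :
    JointAlgebra A d →⋆ₐ[ℂ] JointAlgebra A d :=
  tensorShift (measurable_shiftIn A) (QuasiLocal.shift d)

namespace CQChannel

variable {A : Type*} [MeasurableSpace A] {d : ℕ} [NeZero d]

theorem measurable_apply (W : CQChannel A d) (F : JointAlgebra A d) :
    Measurable fun x => W.toFun x (F.1 x) := by
  obtain ⟨F, hF⟩ := F
  obtain ⟨u, hu, hlim⟩ := mem_closure_iff_seq_limit.1 hF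
  refine measurable_of_tendsto_metrizable (f := fun n x => W.toFun x (u n x)) (fun n => ?_)
    (tendsto_pi_nhds.2 fun x => ?_)
  · obtain ⟨t, ht⟩ := hu n
    rw [← ht]
    clear ht
    induction t using TensorProduct.induction_on with
    | zero => simp
    | add s t hs ht =>
      convert hs.add ht using 1
      ext x
      exact (congrArg (fun G : BoundedFun (ℤ → A) (QuasiLocal d) => W.toFun x (G x))
        (map_add (tensorHom (ℤ → A) (QuasiLocal d)) s t)).trans (map_add (W.toFun x) _ _)
    | tmul f b =>
      have h : ∀ x, W.toFun x (tensorHom (ℤ → A) (QuasiLocal d) (f ⊗ₜ b) x) =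
          (f : BoundedFun (ℤ → A) ℂ) x * W.toFun x b := fun x => by
        rw [tensorHom_tmul, map_smul, smul_eq_mul]
      exact (funext h : (fun x => W.toFun x (tensorHom (ℤ → A) (QuasiLocal d) (f ⊗ₜ b) x)) = _) ▸
        Measurable.mul f.2 (W.measurable_toFun b)
  · rw [tendsto_iff_norm_sub_tendsto_zero] at hlim ⊢
    refine squeeze_zero (fun _ => norm_nonneg _) (fun n => ?_)
      (by simpa using hlim.const_mul 4)
    rw [← map_sub]
    refine (norm_state_le (W.toFun_mem_states x) _).trans ?_
    gcongr
    exact lp.norm_apply_le_norm ENNReal.top_ne_zero (u n - F) x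

theorem integrable_apply (W : CQChannel A d) (F : JointAlgebra A d) (p : Measure (ℤ → A))
    [IsFiniteMeasure p] : Integrable (fun x => W.toFun x (F.1 x)) p :=
  Integrable.of_bound (W.measurable_apply F).aestronglyMeasurable (4 * ‖F.1‖) <|
    Filter.Eventually.of_forall fun x => (norm_state_le (W.toFun_mem_states x) _).trans <| by
      gcongr
      exact lp.norm_apply_le_norm ENNReal.top_ne_zero F.1 x

/-- The joint input-output state of the channel `W` for the input distribution `p`. -/
def jointState (p : Measure (ℤ → A)) [IsProbabilityMeasure p] (W : CQChannel A d) :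
    JointAlgebra A d →ₗ[ℂ] ℂ where
  toFun F := ∫ x, W.toFun x (F.1 x) ∂p
  map_add' F G := by
    rw [← integral_add (W.integrable_apply F p) (W.integrable_apply G p)]
    exact integral_congr_ae (Filter.Eventually.of_forall fun x => map_add (W.toFun x) _ _)
  map_smul' r F := by
    rw [RingHom.id_apply, smul_eq_mul, ← integral_const_mul]
    exact integral_congr_ae (Filter.Eventually.of_forall fun x => map_smul (W.toFun x) r _)

/-- The value `∫ f(x) W(x, b) p(dx)` of the joint state at the elementary tensor `f ⊗ b`. -/
theorem jointState_elemTensor (p : Measure (ℤ → A)) [IsProbabilityMeasure p] (W : CQChannel A d)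
    (f : BddMeas (ℤ → A)) (b : QuasiLocal d) :
    jointState p W (elemTensor f b) = ∫ x, (f : BoundedFun (ℤ → A) ℂ) x * W.toFun x b ∂p := by
  refine integral_congr_ae (Filter.Eventually.of_forall fun x => ?_)
  change W.toFun x (tensorHom (ℤ → A) (QuasiLocal d) (f ⊗ₜ b) x) = _
  rw [tensorHom_tmul, map_smul, smul_eq_mul]

/-- A cq-channel is stationary if `W(T_in x, b) = W(x, T_out b)`. -/
def IsStationary (W : CQChannel A d) : Prop :=
  ∀ x b, W.toFun (shiftIn A x) b = W.toFun x (QuasiLocal.shift d b)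

/-- A stationary cq-channel is ergodic if every stationary ergodic input has an ergodic joint
input-output state. -/
def IsErgodic (W : CQChannel A d) : Prop :=
  W.IsStationary ∧ ∀ (p : Measure (ℤ → A)) [IsProbabilityMeasure p], Ergodic (shiftIn A) p →
    IsErgodicState (jointShift A d) (jointState p W)

/-- Equality of (stationary) cq-channels: they have the same stationary joint input-output
states. -/
def StationaryEq (W₁ W₂ : CQChannel A d) : Prop :=
  ∀ (p : Measure (ℤ → A)) [IsProbabilityMeasure p], MeasurePreserving (shiftIn A) p p →
    ∀ (f : BddMeas (ℤ → A)) (b : QuasiLocal d),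
      jointState p W₁ (elemTensor f b) = jointState p W₂ (elemTensor f b)

open scoped ComplexOrder in
/-- The convex combination `a W₁ + (1 - a) W₂` of two cq-channels. -/
def convexComb (a : ℝ) (ha : a ∈ Set.Ioo (0 : ℝ) 1) (W₁ W₂ : CQChannel A d) : CQChannel A d where
  toFun x := (a : ℂ) • W₁.toFun x + ((1 - a : ℝ) : ℂ) • W₂.toFun x
  measurable_toFun b :=
    ((W₁.measurable_toFun b).const_mul _).add ((W₂.measurable_toFun b).const_mul _)
  toFun_mem_states x := by
    have h₁ := W₁.toFun_mem_states x
    have h₂ := W₂.toFun_mem_states x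
    refine ⟨fun b => ?_, ?_⟩
    · exact add_nonneg
        (mul_nonneg (Complex.zero_le_real.2 ha.1.le) (h₁.1 b))
        (mul_nonneg (Complex.zero_le_real.2 (sub_nonneg.2 ha.2.le)) (h₂.1 b))
    · simp [h₁.2, h₂.2]

theorem IsStationary.convexComb {a : ℝ} (ha : a ∈ Set.Ioo (0 : ℝ) 1) {W₁ W₂ : CQChannel A d}
    (h₁ : W₁.IsStationary) (h₂ : W₂.IsStationary) : (convexComb a ha W₁ W₂).IsStationary :=
  fun x b => by simp [CQChannel.convexComb, h₁ x b, h₂ x b]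

/-- `W` is an extreme point of the convex set of stationary cq-channels, where equality of channels
is understood as having the same stationary joint states. -/
def IsExtremal (W : CQChannel A d) : Prop :=
  W.IsStationary ∧ ∀ W₁ W₂ : CQChannel A d, W₁.IsStationary → W₂.IsStationary →
    ∀ (a : ℝ) (ha : a ∈ Set.Ioo (0 : ℝ) 1), StationaryEq W (convexComb a ha W₁ W₂) →
      StationaryEq W₁ W₂

end CQChannel

end Channels

end CQ

end

/-! ### Existence of ergodic measures charging a given set -/

section ErgodicMeasures

open MeasureTheory Set Filter Topology
open scoped ENNReal BoundedContinuousFunction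

variable {X : Type*} [TopologicalSpace X] [MeasurableSpace X] [BorelSpace X]
  [HasOuterApproxClosed X]

/-! Joint states and channels determine each other up to null sets: `W` is itself a density of
`jointState p W` with respect to `p`, and densities are almost everywhere unique
(`IsDensity.ae_eq`). Decomposing `W` is therefore compared with decomposing its joint states.

Ergodic implies extremal. If `W` is a proper mixture of `W₁` and `W₂`, extremality of its joint
state forces the joint states of `W₁` and `W₂` to coincide for every ergodic input. To pass to an
arbitrary stationary `p`, fix `b` and suppose that `p` charges the set where the two channels differ
at `b`. Then some ergodic measure charges it too (`exists_ergodic_measure_pos`), against uniqueness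
of densities. Compactness and Krein–Milman give this ergodic measure, so no ergodic decomposition is
needed.

Extremal implies ergodic. For ergodic `p`, let `jointState p W` be a proper mixture of stationary
states `ψ₁` and `ψ₂`. Each is dominated by a multiple of the joint state, so Radon–Nikodym and
separability of the output algebra provide a density (`exists_isDensity`). Almost everywhere this
density is a state and intertwines the shifts; its value at the unit is shift-invariant, hence `1`
by ergodicity. On an invariant set of full measure the densities replace `W`, and off it `W` is
kept. This produces two stationary channels whose mixture is `W` at every point. Extremality
identifies them, hence also `ψ₁` and `ψ₂`. -/

theorem upperSemicontinuous_measure_of_isClosed {K : Set X} (hK : IsClosed K) :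
    UpperSemicontinuous fun p : ProbabilityMeasure X => (p : Measure X) K := by
  intro p y hy
  exact eventually_lt_of_limsup_lt
    ((ProbabilityMeasure.limsup_measure_closed_le_of_tendsto tendsto_id hK).trans_lt hy)

theorem isClosed_setOf_measurePreserving {T : X → X} (hT : Continuous T) :
    IsClosed {p : ProbabilityMeasure X | MeasurePreserving T (p : Measure X) (p : Measure X)} := by
  have h : {p : ProbabilityMeasure X | MeasurePreserving T (p : Measure X) (p : Measure X)} =
      {p | p.map hT.measurable.aemeasurable = p} := by
    ext p
    refine ⟨fun hp => Subtype.ext hp.map_eq, fun hp => ⟨hT.measurable, ?_⟩⟩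
    exact congrArg Subtype.val hp
  rw [h]
  exact isClosed_eq (ProbabilityMeasure.continuous_map hT) continuous_id

/-- The mass of a closed set is upper semicontinuous, so it attains a maximum on the compact set of
invariant measures. The maximizers form a compact face; an extreme point of this face is extreme
among all invariant measures, hence ergodic, and its mass on `K` is at least that of `p`. -/
theorem exists_ergodic_measure_isClosed_pos [T2Space X] [CompactSpace X] {T : X → X}
    (hT : Continuous T) {p : Measure X} [IsProbabilityMeasure p] (hp : MeasurePreserving T p p) {K : Set X}
    (hK : IsClosed K) (hpK : 0 < p K) :
    ∃ q : Measure X, IsProbabilityMeasure q ∧ Ergodic T q ∧ 0 < q K := by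
  set M : Set (ProbabilityMeasure X) :=
    {p | MeasurePreserving T (p : Measure X) (p : Measure X)} with hM
  have hMc : IsCompact M := (isClosed_setOf_measurePreserving hT).isCompact
  have husc := upperSemicontinuous_measure_of_isClosed hK
  obtain ⟨r, hrM, hr⟩ := (husc.upperSemicontinuousOn M).exists_isMaxOn ⟨⟨p, ‹_›⟩, hp⟩ hMc
  set E : Set (ProbabilityMeasure X) := M ∩ {q | (r : Measure X) K ≤ (q : Measure X) K}
  have hEc : IsCompact E := hMc.inter_right (husc.isClosed_preimage _)
  -- Krein–Milman needs a locally convex vector space, so measures are embedded as functionals on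
  -- bounded continuous functions, with the product topology.
  let Φ : ProbabilityMeasure X → (X →ᵇ ℝ) → ℝ := fun q f => ∫ x, f x ∂(q : Measure X)
  have hΦ : Continuous Φ := continuous_pi fun f =>
    ProbabilityMeasure.continuous_iff_forall_continuous_integral.1 continuous_id f
  have hΦi : Function.Injective Φ := fun q₁ q₂ h =>
    Subtype.ext (ext_of_forall_integral_eq_of_IsFiniteMeasure (μ := (q₁ : Measure X))
      (ν := (q₂ : Measure X)) fun f => congrFun h f)
  obtain ⟨_, ⟨q, hqE, rfl⟩, hq⟩ :=
    (hEc.image hΦ).extremePoints_nonempty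
      (Set.Nonempty.image Φ ⟨r, hrM, le_refl ((r : Measure X) K)⟩)
  refine ⟨q, inferInstance, Ergodic.of_mem_extremePoints ?_,
    (hpK.trans_le (hr (a := ⟨p, ‹_›⟩) hp)).trans_le hqE.2⟩
  rw [mem_extremePoints_iff_left]
  refine ⟨⟨hqE.1, inferInstance⟩, ?_⟩
  rintro ν₁ ⟨hν₁, hν₁'⟩ ν₂ ⟨hν₂, hν₂'⟩ ⟨a, b, ha, hb, hab, h⟩
  have h₁ : ν₁ K ≤ (r : Measure X) K := hr (a := ⟨ν₁, ‹_›⟩) hν₁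
  have h₂ : ν₂ K ≤ (r : Measure X) K := hr (a := ⟨ν₂, ‹_›⟩) hν₂
  have hat : a ≠ ∞ := fun h => by simp [h] at hab
  have hbt : b ≠ ∞ := fun h => by simp [h] at hab
  have hle : (r : Measure X) K ≤ a * ν₁ K + b * ν₂ K := by
    have := hqE.2
    rw [Set.mem_ofPred_eq, ← h] at this
    simpa using this
  have hr1 : (r : Measure X) K ≠ ∞ := measure_ne_top _ _
  have hmul : (r : Measure X) K = a * (r : Measure X) K + b * (r : Measure X) K := by
    rw [← add_mul, hab, one_mul]
  -- The face property: an average of two numbers, each at most the maximum, reaches the maximum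
  -- only if both do.
  have key₁ : (r : Measure X) K ≤ ν₁ K := by
    have : a * (r : Measure X) K + b * (r : Measure X) K ≤ a * ν₁ K + b * (r : Measure X) K := by
      rw [← hmul]
      exact hle.trans (by gcongr)
    rw [ENNReal.add_le_add_iff_right (ENNReal.mul_ne_top hbt hr1)] at this
    exact (ENNReal.mul_le_mul_iff_right ha.ne' hat).1 this
  have key₂ : (r : Measure X) K ≤ ν₂ K := by
    have : a * (r : Measure X) K + b * (r : Measure X) K ≤ a * (r : Measure X) K + b * ν₂ K := by
      rw [← hmul]
      exact hle.trans (by gcongr)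
    rw [ENNReal.add_le_add_iff_left (ENNReal.mul_ne_top hat hr1)] at this
    exact (ENNReal.mul_le_mul_iff_right hb.ne' hbt).1 this
  have hseg : Φ q ∈ openSegment ℝ (Φ ⟨ν₁, hν₁'⟩) (Φ ⟨ν₂, hν₂'⟩) := by
    refine ⟨a.toReal, b.toReal, ENNReal.toReal_pos ha.ne' hat, ENNReal.toReal_pos hb.ne' hbt, ?_, ?_⟩
    · rw [← ENNReal.toReal_add hat hbt, hab, ENNReal.toReal_one]
    · ext f
      change a.toReal * ∫ x, f x ∂ν₁ + b.toReal * ∫ x, f x ∂ν₂ = ∫ x, f x ∂(q : Measure X)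
      rw [← h, integral_add_measure ((f.integrable _).smul_measure hat)
        ((f.integrable _).smul_measure hbt), integral_smul_measure, integral_smul_measure]
      rfl
  exact congrArg Subtype.val (hΦi (hq ⟨⟨ν₁, hν₁'⟩, ⟨hν₁, key₁⟩, rfl⟩
    ⟨⟨ν₂, hν₂'⟩, ⟨hν₂, key₂⟩, rfl⟩ hseg))

/-- If an invariant probability measure charges a measurable set, then so does some ergodic one. -/
theorem exists_ergodic_measure_pos {X : Type*} [TopologicalSpace X] [MeasurableSpace X]
    [BorelSpace X] [TopologicalSpace.MetrizableSpace X] [CompactSpace X] {T : X → X}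
    (hT : Continuous T) {p : Measure X} [IsProbabilityMeasure p] (hp : MeasurePreserving T p p)
    {N : Set X} (hN : MeasurableSet N) (hpN : 0 < p N) :
    ∃ q : Measure X, IsProbabilityMeasure q ∧ Ergodic T q ∧ 0 < q N := by
  -- Inner regularity reduces the claim to a closed set, where semicontinuity is available.
  obtain ⟨K, hKN, hK, hpK⟩ := hN.exists_lt_isClosed_of_ne_top (measure_ne_top p N) hpN
  obtain ⟨q, hq, hqe, hqK⟩ := exists_ergodic_measure_isClosed_pos hT hp hK hpK
  exact ⟨q, hq, hqe, hqK.trans_le (measure_mono hKN)⟩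

end ErgodicMeasures

noncomputable section

namespace CQ

/-! ### Positive functionals, elementary tensors and density -/

section Functionals

variable {𝒜 : Type*} [CStarAlgebra 𝒜]

open scoped ComplexOrder in
-- A positive functional is controlled by its value at the unit; the factor 4 counts the positive
-- pieces into which `a` is split. Keeping `‖φ 1‖` matters for the functionals `b ↦ ψ (1_E ⊗ b)`,
-- whose value at the unit will be bounded by a multiple of `p E`.
theorem norm_apply_le_of_forall_nonneg {φ : 𝒜 →ₗ[ℂ] ℂ} (hφ : ∀ a, 0 ≤ φ (star a * a)) (a : 𝒜) :
    ‖φ a‖ ≤ 4 * (‖a‖ * ‖φ 1‖) := by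
  let := CStarAlgebra.spectralOrder 𝒜
  let := CStarAlgebra.spectralOrderedRing 𝒜
  have hpos : ∀ b : 𝒜, 0 ≤ b → 0 ≤ φ b := fun b hb => by
    obtain ⟨c, rfl⟩ := CStarAlgebra.nonneg_iff_eq_star_mul_self.1 hb
    exact hφ c
  have hb : ∀ b : 𝒜, 0 ≤ b → ‖φ b‖ ≤ ‖b‖ * ‖φ 1‖ := fun b hb => by
    have h1 : 0 ≤ φ (algebraMap ℂ 𝒜 (‖b‖ : ℂ) - b) :=
      hpos _ (sub_nonneg.2 ((IsSelfAdjoint.of_nonneg hb).le_algebraMap_norm_self.trans_eq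
        (IsScalarTower.algebraMap_apply ℝ ℂ 𝒜 ‖b‖)))
    rw [map_sub, Algebra.algebraMap_eq_smul_one, map_smul, smul_eq_mul, sub_nonneg] at h1
    have h2 := CStarAlgebra.norm_le_norm_of_nonneg_of_le (hpos b hb) h1
    simpa using h2
  obtain ⟨y, hy0, hy1, hy⟩ := CStarAlgebra.exists_sum_four_nonneg a
  conv_lhs => rw [hy]
  rw [map_sum]
  refine (norm_sum_le _ _).trans
    ((Finset.sum_le_sum (g := fun _ => ‖a‖ * ‖φ 1‖) fun i _ => ?_).trans ?_)
  · rw [map_smul, norm_smul]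
    have := (hb _ (hy0 i)).trans (mul_le_mul_of_nonneg_right (hy1 i) (norm_nonneg (φ 1)))
    simpa using this
  · simp

theorem continuous_of_mem_states {ψ : 𝒜 →ₗ[ℂ] ℂ} (hψ : ψ ∈ states 𝒜) : Continuous ψ :=
  AddMonoidHomClass.continuous_of_bound ψ 4 (norm_state_le hψ)

end Functionals

section Tensor

open scoped ENNReal TensorProduct
open MeasureTheory

variable {X : Type*} [MeasurableSpace X] {𝔅 : Type*} [CStarAlgebra 𝔅] [NormOneClass 𝔅]

theorem elemTensor_apply (f : BddMeas X) (b : 𝔅) (x : X) :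
    (elemTensor f b).1 x = (f : BoundedFun X ℂ) x • b :=
  tensorHom_tmul f b x

theorem tensorAlgebra_ext {F G : tensorAlgebra X 𝔅} (h : ∀ x, F.1 x = G.1 x) : F = G :=
  Subtype.ext (lp.ext (funext h))

theorem elemTensor_add_left (f g : BddMeas X) (b : 𝔅) :
    elemTensor (f + g) b = elemTensor f b + elemTensor g b :=
  Subtype.ext <| by
    change tensorHom X 𝔅 _ = tensorHom X 𝔅 _ + tensorHom X 𝔅 _
    rw [TensorProduct.add_tmul, map_add]

theorem elemTensor_add_right (f : BddMeas X) (b c : 𝔅) :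
    elemTensor f (b + c) = elemTensor f b + elemTensor f c :=
  Subtype.ext <| by
    change tensorHom X 𝔅 _ = tensorHom X 𝔅 _ + tensorHom X 𝔅 _
    rw [TensorProduct.tmul_add, map_add]

theorem elemTensor_smul_left (r : ℂ) (f : BddMeas X) (b : 𝔅) :
    elemTensor (r • f) b = r • elemTensor f b :=
  Subtype.ext <| by
    change tensorHom X 𝔅 _ = r • tensorHom X 𝔅 _
    rw [← TensorProduct.smul_tmul', map_smul]

theorem elemTensor_smul_right (r : ℂ) (f : BddMeas X) (b : 𝔅) :
    elemTensor f (r • b) = r • elemTensor f b :=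
  Subtype.ext <| by
    change tensorHom X 𝔅 _ = r • tensorHom X 𝔅 _
    rw [TensorProduct.tmul_smul, map_smul]

theorem star_elemTensor_mul_self (f : BddMeas X) (b : 𝔅) :
    star (elemTensor f b) * elemTensor f b = elemTensor (star f * f) (star b * b) :=
  Subtype.ext <| by
    change star (tensorHom X 𝔅 _) * tensorHom X 𝔅 _ = tensorHom X 𝔅 _
    rw [← map_star, ← map_mul, TensorProduct.star_tmul, Algebra.TensorProduct.tmul_mul_tmul]

theorem norm_elemTensor_le (f : BddMeas X) (b : 𝔅) : ‖elemTensor f b‖ ≤ ‖f‖ * ‖b‖ := by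
  refine lp.norm_le_of_forall_le (by positivity) fun x => ?_
  change ‖tensorHom X 𝔅 (f ⊗ₜ b) x‖ ≤ _
  rw [tensorHom_tmul, norm_smul]
  gcongr
  exact lp.norm_apply_le_norm ENNReal.top_ne_zero (f : BoundedFun X ℂ) x

/-- The elementary tensor as a linear function of its first factor. -/
def elemTensorLeft (b : 𝔅) : BddMeas X →ₗ[ℂ] tensorAlgebra X 𝔅 where
  toFun f := elemTensor f b
  map_add' f g := elemTensor_add_left f g b
  map_smul' r f := elemTensor_smul_left r f b

/-- The elementary tensor as a linear function of its second factor. -/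
def elemTensorRight (f : BddMeas X) : 𝔅 →ₗ[ℂ] tensorAlgebra X 𝔅 where
  toFun b := elemTensor f b
  map_add' b c := elemTensor_add_right f b c
  map_smul' r b := elemTensor_smul_right r f b

theorem continuous_elemTensorLeft (b : 𝔅) : Continuous (elemTensorLeft (X := X) b) :=
  AddMonoidHomClass.continuous_of_bound _ ‖b‖ fun f =>
    (norm_elemTensor_le f b).trans_eq (mul_comm _ _)

/-- A simple function as a bounded measurable function. -/
def simpleBddMeas (s : SimpleFunc X ℂ) : BddMeas X :=
  ⟨BoundedFun.mk s s.exists_forall_norm_le.choose s.exists_forall_norm_le.choose_spec,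
    s.measurable⟩

theorem bddMeas_ext {f g : BddMeas X} (h : ∀ x, (f : BoundedFun X ℂ) x = (g : BoundedFun X ℂ) x) :
    f = g :=
  Subtype.ext (lp.ext (funext h))

/-- The indicator function of a measurable set. -/
def indicatorBddMeas (E : Set X) (hE : MeasurableSet E) : BddMeas X :=
  simpleBddMeas (SimpleFunc.piecewise E hE (SimpleFunc.const X 1) (SimpleFunc.const X 0))

open Classical in
theorem indicatorBddMeas_apply (E : Set X) (hE : MeasurableSet E) (x : X) :
    (indicatorBddMeas E hE : BoundedFun X ℂ) x = if x ∈ E then 1 else 0 := by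
  change SimpleFunc.piecewise E hE _ _ x = _
  rw [SimpleFunc.piecewise_apply]
  congr

theorem simpleBddMeas_mem_span (s : SimpleFunc X ℂ) :
    simpleBddMeas s ∈ Submodule.span ℂ (Set.range fun E : {E : Set X // MeasurableSet E} =>
      indicatorBddMeas E.1 E.2) := by
  classical
  induction s using SimpleFunc.induction with
  | @const c E hE =>
    have : simpleBddMeas (SimpleFunc.piecewise E hE (SimpleFunc.const X c) (SimpleFunc.const X 0)) =
        c • indicatorBddMeas E hE := bddMeas_ext fun x => by
      change SimpleFunc.piecewise E hE _ _ x = c * (indicatorBddMeas E hE : BoundedFun X ℂ) x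
      rw [indicatorBddMeas_apply, SimpleFunc.piecewise_apply]
      split_ifs <;> simp
    rw [this]
    exact Submodule.smul_mem _ _ (Submodule.subset_span ⟨⟨E, hE⟩, rfl⟩)
  | @add s t _ hs ht =>
    have : simpleBddMeas (s + t) = simpleBddMeas s + simpleBddMeas t := bddMeas_ext fun x => rfl
    rw [this]
    exact Submodule.add_mem _ hs ht

/-- The range of `f` lies in a compact disc, so finitely many terms of a dense sequence come within
`ε` of every value. Sending each value to a nearest one among finitely many terms gives a simple
function that is uniformly close. -/
theorem exists_simpleBddMeas_norm_sub_le (f : BddMeas X) {ε : ℝ} (hε : 0 < ε) :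
    ∃ s : SimpleFunc X ℂ, ‖simpleBddMeas s - f‖ ≤ ε := by
  set e : ℕ → ℂ := TopologicalSpace.denseSeq ℂ
  obtain ⟨t, ht⟩ := (isCompact_closedBall (0 : ℂ) ‖f‖).elim_finite_subcover
    (fun k => Metric.ball (e k) ε) (fun k => Metric.isOpen_ball) fun z _ => by
      obtain ⟨k, hk⟩ := (TopologicalSpace.denseRange_denseSeq ℂ).exists_dist_lt z hε
      exact Set.mem_iUnion.2 ⟨k, hk⟩
  refine ⟨(SimpleFunc.nearestPt e (t.sup id)).comp (f : BoundedFun X ℂ) f.2,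
    lp.norm_le_of_forall_le hε.le fun x => ?_⟩
  obtain ⟨k, hk, hxk⟩ := Set.mem_iUnion₂.1 (ht (mem_closedBall_zero_iff.2
    (lp.norm_apply_le_norm ENNReal.top_ne_zero (f : BoundedFun X ℂ) x)))
  have h := SimpleFunc.edist_nearestPt_le e ((f : BoundedFun X ℂ) x)
    (Finset.le_sup (f := id) hk : k ≤ t.sup id)
  rw [edist_dist, edist_dist, ENNReal.ofReal_le_ofReal_iff dist_nonneg] at h
  change ‖SimpleFunc.nearestPt e (t.sup id) ((f : BoundedFun X ℂ) x) - (f : BoundedFun X ℂ) x‖ ≤ ε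
  rw [← dist_eq_norm]
  exact h.trans ((dist_comm _ _).trans_le (Metric.mem_ball.1 hxk).le)

theorem dense_span_indicatorBddMeas :
    Dense (Submodule.span ℂ (Set.range fun E : {E : Set X // MeasurableSet E} =>
      indicatorBddMeas E.1 E.2) : Set (BddMeas X)) := by
  refine Metric.dense_iff.2 fun f ε hε => ?_
  obtain ⟨s, hs⟩ := exists_simpleBddMeas_norm_sub_le f (half_pos hε)
  exact ⟨simpleBddMeas s, mem_ball_iff_norm.2 (hs.trans_lt (half_lt_self hε)),
    simpleBddMeas_mem_span s⟩

theorem eq_of_forall_elemTensor {ψ₁ ψ₂ : tensorAlgebra X 𝔅 →ₗ[ℂ] ℂ} (h₁ : Continuous ψ₁)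
    (h₂ : Continuous ψ₂) (h : ∀ f b, ψ₁ (elemTensor f b) = ψ₂ (elemTensor f b)) : ψ₁ = ψ₂ := by
  have hd : Dense {F : tensorAlgebra X 𝔅 | F.1 ∈ (tensorHom X 𝔅).range} := fun F => by
    rw [Topology.IsInducing.subtypeVal.closure_eq_preimage_closure_image]
    refine closure_mono ?_ F.2
    rintro G hG
    exact ⟨⟨G, StarSubalgebra.le_topologicalClosure _ hG⟩, hG, rfl⟩
  refine DFunLike.ext' (Continuous.ext_on hd h₁ h₂ ?_)
  rintro ⟨_, hF⟩ ⟨t, rfl⟩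
  have hmem : ∀ t, tensorHom X 𝔅 t ∈ tensorAlgebra X 𝔅 := fun t =>
    StarSubalgebra.le_topologicalClosure _ ⟨t, rfl⟩
  change ψ₁ ⟨tensorHom X 𝔅 t, hmem t⟩ = ψ₂ ⟨tensorHom X 𝔅 t, hmem t⟩
  clear hF
  induction t using TensorProduct.induction_on with
  | zero =>
    have : (⟨tensorHom X 𝔅 0, hmem 0⟩ : tensorAlgebra X 𝔅) = 0 := Subtype.ext (map_zero _)
    rw [this, map_zero, map_zero]
  | tmul f b => exact h f b
  | add s t hs ht =>
    have : (⟨tensorHom X 𝔅 (s + t), hmem _⟩ : tensorAlgebra X 𝔅) =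
        ⟨tensorHom X 𝔅 s, hmem _⟩ + ⟨tensorHom X 𝔅 t, hmem _⟩ := Subtype.ext (map_add _ _ _)
    rw [this, map_add, map_add, hs, ht]

/-- Indicators span a dense subspace of the first factor. A density only prescribes integrals over
measurable sets, and this is why such data determine the functional. -/
theorem eq_of_forall_elemTensor_indicator {ψ₁ ψ₂ : tensorAlgebra X 𝔅 →ₗ[ℂ] ℂ} (h₁ : Continuous ψ₁)
    (h₂ : Continuous ψ₂) (h : ∀ (E : Set X) (hE : MeasurableSet E) (b : 𝔅),
      ψ₁ (elemTensor (indicatorBddMeas E hE) b) = ψ₂ (elemTensor (indicatorBddMeas E hE) b)) :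
    ψ₁ = ψ₂ := by
  refine eq_of_forall_elemTensor h₁ h₂ fun f b => ?_
  refine congrFun (Continuous.ext_on dense_span_indicatorBddMeas
    (h₁.comp (continuous_elemTensorLeft b)) (h₂.comp (continuous_elemTensorLeft b)) ?_) f
  refine LinearMap.eqOn_span (f := ψ₁ ∘ₗ elemTensorLeft b) (g := ψ₂ ∘ₗ elemTensorLeft b) ?_
  rintro _ ⟨E, rfl⟩
  exact h E.1 E.2 b

end Tensor

/-! ### Separability of the quasi-local algebra. -/

section Separable

open scoped Matrix.Norms.L2Operator
open TopologicalSpace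

variable (d : ℕ) [NeZero d]

/-- There are countably many finite sets of sites, each carrying a finite-dimensional algebra.
Separability lets conditions on all `b` be tested on a sequence, so that only countably many null
sets are discarded. -/
instance : SeparableSpace (LocalObservables d) := by
  rw [← isSeparable_univ_iff]
  have h : (Set.univ : Set (LocalObservables d)) =
      ⋃ Λ : Finset ℤ, Set.range (LocalObservables.of (d := d) Λ) :=
    (Set.eq_univ_of_forall fun a => by
      obtain ⟨Λ, a, rfl⟩ := LocalObservables.exists_of a
      exact Set.mem_iUnion.2 ⟨Λ, a, rfl⟩).symm
  rw [h]
  refine IsSeparable.iUnion fun Λ => ?_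
  have : SeparableSpace (LocalAlgebra d Λ) :=
    have := FiniteDimensional.proper ℂ (LocalAlgebra d Λ)
    inferInstance
  exact isSeparable_range (AddMonoidHomClass.isometry_of_norm (LocalObservables.of (d := d) Λ)
    (LocalObservables.norm_of Λ)).continuous

instance : SeparableSpace (QuasiLocal d) :=
  inferInstanceAs (SeparableSpace (UniformSpace.Completion (LocalObservables d)))

end Separable

/-! ### Densities, and modifications that are Lipschitz in a parameter -/

section Densities

open MeasureTheory Filter Topology
open scoped ENNReal

variable {X : Type*} [MeasurableSpace X] {p : Measure X}

/-- Real and imaginary parts are each compared with the constants `C` and `-C`. Adding the two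
bounds gives the factor 2, which is not sharp but suffices. -/
theorem ae_norm_le_of_forall_setIntegral_norm_le [IsFiniteMeasure p] {w : X → ℂ}
    (hw : Integrable w p) {C : ℝ}
    (h : ∀ E, MeasurableSet E → ‖∫ x in E, w x ∂p‖ ≤ C * p.real E) :
    ∀ᵐ x ∂p, ‖w x‖ ≤ 2 * C := by
  have hre : ∀ E, ∫ x in E, (w x).re ∂p = (∫ x in E, w x ∂p).re := fun E =>
    integral_re (𝕜 := ℂ) hw.integrableOn
  have him : ∀ E, ∫ x in E, (w x).im ∂p = (∫ x in E, w x ∂p).im := fun E =>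
    integral_im (𝕜 := ℂ) hw.integrableOn
  have hC : ∀ (c : ℝ) (E : Set X), ∫ _ in E, c ∂p = c * p.real E := fun c E => by
    rw [setIntegral_const, smul_eq_mul, mul_comm]
  have h1 : (fun x => (w x).re) ≤ᵐ[p] fun _ => C :=
    ae_le_of_forall_setIntegral_le hw.re (integrable_const _) fun E hE _ => by
      rw [hre, hC]; exact (Complex.re_le_norm _).trans (h E hE)
  have h2 : (fun x => (w x).im) ≤ᵐ[p] fun _ => C :=
    ae_le_of_forall_setIntegral_le hw.im (integrable_const _) fun E hE _ => by
      rw [him, hC]; exact (Complex.im_le_norm _).trans (h E hE)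
  have h3 : (fun _ => -C) ≤ᵐ[p] fun x => (w x).re :=
    ae_le_of_forall_setIntegral_le (integrable_const _) hw.re fun E hE _ => by
      rw [hre, hC]
      linarith [(abs_le.1 ((Complex.abs_re_le_norm _).trans (h E hE))).1]
  have h4 : (fun _ => -C) ≤ᵐ[p] fun x => (w x).im :=
    ae_le_of_forall_setIntegral_le (integrable_const _) hw.im fun E hE _ => by
      rw [him, hC]
      linarith [(abs_le.1 ((Complex.abs_im_le_norm _).trans (h E hE))).1]
  filter_upwards [h1, h2, h3, h4] with x h1 h2 h3 h4
  have := Complex.norm_le_abs_re_add_abs_im (w x)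
  linarith [abs_le.2 ⟨h3, h1⟩, abs_le.2 ⟨h4, h2⟩]

open scoped ComplexOrder in
theorem ae_nonneg_of_forall_setIntegral_nonneg' [IsFiniteMeasure p] {w : X → ℂ}
    (hw : Integrable w p) (h : ∀ E, MeasurableSet E → 0 ≤ ∫ x in E, w x ∂p) :
    ∀ᵐ x ∂p, 0 ≤ w x := by
  have hre : ∀ E, ∫ x in E, (w x).re ∂p = (∫ x in E, w x ∂p).re := fun E =>
    integral_re (𝕜 := ℂ) hw.integrableOn
  have him : ∀ E, ∫ x in E, (w x).im ∂p = (∫ x in E, w x ∂p).im := fun E =>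
    integral_im (𝕜 := ℂ) hw.integrableOn
  have h1 : 0 ≤ᵐ[p] fun x => (w x).re :=
    ae_nonneg_of_forall_setIntegral_nonneg hw.re fun E hE _ => by
      rw [hre]; exact (Complex.nonneg_iff.1 (h E hE)).1
  have h2 : (fun x => (w x).im) =ᵐ[p] 0 :=
    hw.im.ae_eq_zero_of_forall_setIntegral_eq_zero fun E hE _ => by
      exact (him E).trans (Complex.nonneg_iff.1 (h E hE)).2.symm
  filter_upwards [h1, h2] with x h1 h2
  exact Complex.nonneg_iff.2 ⟨h1, h2.symm⟩

theorem indicatorBddMeas_add {E F : Set X} (hE : MeasurableSet E) (hF : MeasurableSet F)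
    (h : Disjoint E F) : indicatorBddMeas (E ∪ F) (hE.union hF) =
      indicatorBddMeas E hE + indicatorBddMeas F hF := by
  classical
  refine bddMeas_ext fun x => ?_
  change _ = (indicatorBddMeas E hE : BoundedFun X ℂ) x + (indicatorBddMeas F hF : BoundedFun X ℂ) x
  rw [indicatorBddMeas_apply, indicatorBddMeas_apply, indicatorBddMeas_apply]
  by_cases h1 : x ∈ E <;> by_cases h2 : x ∈ F
  · exact (Set.disjoint_left.1 h h1 h2).elim
  all_goals simp [h1, h2]

theorem indicatorBddMeas_empty : indicatorBddMeas (∅ : Set X) MeasurableSet.empty = 0 :=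
  bddMeas_ext fun x => by
    rw [indicatorBddMeas_apply, if_neg (Set.notMem_empty x)]
    rfl

open Classical in
/-- A functional on the bounded measurable functions that is dominated on the indicator functions
by a finite measure is a complex measure. -/
def complexMeasureOf [IsFiniteMeasure p] (φ : BddMeas X →ₗ[ℂ] ℂ) (C : ℝ)
    (hφ : ∀ E hE, ‖φ (indicatorBddMeas E hE)‖ ≤ C * p.real E) : ComplexMeasure X where
  measureOf' E := if hE : MeasurableSet E then φ (indicatorBddMeas E hE) else 0
  empty' := by rw [dif_pos MeasurableSet.empty, indicatorBddMeas_empty, map_zero]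
  not_measurable' E hE := dif_neg hE
  m_iUnion' f hf hd := by
    have hU : MeasurableSet (⋃ i, f i) := MeasurableSet.iUnion hf
    simp only [dif_pos hU, dif_pos (hf _)]
    have hsum : ∀ s : Finset ℕ, ∑ i ∈ s, φ (indicatorBddMeas (f i) (hf i)) =
        φ (indicatorBddMeas (⋃ i ∈ s, f i) (s.measurableSet_biUnion fun i _ => hf i)) := by
      intro s
      induction s using Finset.induction_on with
      | empty =>
        have : (⋃ i ∈ (∅ : Finset ℕ), f i) = ∅ := by simp
        simp only [this, Finset.sum_empty, indicatorBddMeas_empty, map_zero]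
      | insert i s hi ih =>
        have hdis : Disjoint (f i) (⋃ j ∈ s, f j) := by
          rw [Set.disjoint_iUnion₂_right]
          exact fun j hj => hd fun h => hi (h ▸ hj)
        simp only [Finset.set_biUnion_insert]
        rw [Finset.sum_insert hi, ih, ← map_add, ← indicatorBddMeas_add _ _ hdis]
    have hp : HasSum (fun i => p.real (f i)) (p.real (⋃ i, f i)) := by
      have hU' := measure_iUnion (μ := p) hd hf
      have := ENNReal.hasSum_toReal (hU' ▸ measure_ne_top p (⋃ i, f i))
      rwa [← ENNReal.tsum_toReal_eq (fun i => measure_ne_top p (f i)), ← hU'] at this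
    rw [HasSum, SummationFilter.unconditional_filter] at hp ⊢
    -- Finite additivity turns the error of a partial sum into the value of `φ` on the remaining
    -- set, which is dominated by `C` times the `p`-measure of that set and so tends to zero.
    rw [tendsto_iff_norm_sub_tendsto_zero]
    refine squeeze_zero (fun _ => norm_nonneg _) (fun s => ?_)
      (by simpa using (hp.const_sub (p.real (⋃ i, f i))).const_mul C)
    have hs : MeasurableSet (⋃ i ∈ s, f i) := s.measurableSet_biUnion fun i _ => hf i
    have hsub : (⋃ i ∈ s, f i) ⊆ ⋃ i, f i := Set.iUnion₂_subset_iUnion _ _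
    have hsplit := indicatorBddMeas_add hs (hU.diff hs) Set.disjoint_sdiff_right
    simp only [Set.union_sdiff_cancel hsub] at hsplit
    rw [hsum, hsplit, map_add, sub_add_cancel_left, norm_neg]
    refine (hφ _ _).trans_eq ?_
    rw [measureReal_sdiff hsub hs, measureReal_biUnion_finset (fun i _ j _ h => hd h)
      (fun i _ => hf i)]

/-- Domination makes the associated complex measure absolutely continuous, so Radon–Nikodym applies
to its real and imaginary parts. -/
theorem exists_density [IsFiniteMeasure p] (φ : BddMeas X →ₗ[ℂ] ℂ) (C : ℝ)
    (hφ : ∀ E hE, ‖φ (indicatorBddMeas E hE)‖ ≤ C * p.real E) :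
    ∃ w : X → ℂ, Measurable w ∧ Integrable w p ∧
      ∀ E hE, ∫ x in E, w x ∂p = φ (indicatorBddMeas E hE) := by
  set m := complexMeasureOf φ C hφ with hm
  have hmE : ∀ E (hE : MeasurableSet E), m E = φ (indicatorBddMeas E hE) := fun E hE => dif_pos hE
  have hac : ∀ E, p E = 0 → m E = 0 := fun E h0 => by
    by_cases hE : MeasurableSet E
    · rw [hmE E hE, ← norm_le_zero_iff]
      refine (hφ E hE).trans_eq ?_
      rw [Measure.real, h0, ENNReal.toReal_zero, mul_zero]
    · exact m.not_measurable hE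
  have hre : (ComplexMeasure.re m).AbsolutelyContinuous p.toENNRealVectorMeasure :=
    VectorMeasure.AbsolutelyContinuous.mk fun E hE h0 => by
      rw [Measure.toENNRealVectorMeasure_apply_measurable hE] at h0
      change (m E).re = 0
      rw [hac E h0, Complex.zero_re]
  have him : (ComplexMeasure.im m).AbsolutelyContinuous p.toENNRealVectorMeasure :=
    VectorMeasure.AbsolutelyContinuous.mk fun E hE h0 => by
      rw [Measure.toENNRealVectorMeasure_apply_measurable hE] at h0
      change (m E).im = 0
      rw [hac E h0, Complex.zero_im]
  set f := SignedMeasure.rnDeriv (ComplexMeasure.re m) p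
  set g := SignedMeasure.rnDeriv (ComplexMeasure.im m) p
  have hf : Integrable f p := SignedMeasure.integrable_rnDeriv _ _
  have hg : Integrable g p := SignedMeasure.integrable_rnDeriv _ _
  have hfg : Integrable (fun x => (f x : ℂ) + g x * Complex.I) p :=
    hf.ofReal.add (hg.ofReal.mul_const _)
  refine ⟨_, ?_, hfg, fun E hE => ?_⟩
  · have hf' : Measurable f := SignedMeasure.measurable_rnDeriv _ _
    have hg' : Measurable g := SignedMeasure.measurable_rnDeriv _ _
    fun_prop
  · rw [← hmE E hE]
    have h1 : ∫ x in E, f x ∂p = (m E).re := by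
      rw [← withDensityᵥ_apply hf hE, SignedMeasure.withDensityᵥ_rnDeriv_eq _ _ hre]
      rfl
    have h2 : ∫ x in E, g x ∂p = (m E).im := by
      rw [← withDensityᵥ_apply hg hE, SignedMeasure.withDensityᵥ_rnDeriv_eq _ _ him]
      rfl
    rw [integral_add hf.ofReal.restrict (hg.ofReal.mul_const _).restrict,
      integral_mul_const, integral_complex_ofReal, integral_complex_ofReal, h1, h2]
    exact Complex.re_add_im _

/-- The Lipschitz bounds hold simultaneously only for countably many parameters. They are imposed on
a dense sequence, the functions are set to zero where a bound fails, and limits along the sequence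
extend them to every parameter. The bound then holds at every point, whereas agreement with `w b`
holds off a null set depending on `b`. -/
theorem exists_lipschitz_modification {B : Type*} [PseudoMetricSpace B]
    [TopologicalSpace.SeparableSpace B] {w : B → X → ℂ} (hw : ∀ b, Measurable (w b)) {C : ℝ}
    (hC : 0 ≤ C) (h : ∀ b c, ∀ᵐ x ∂p, dist (w b x) (w c x) ≤ C * dist b c) :
    ∃ V : X → B → ℂ, (∀ b, Measurable fun x => V x b) ∧
      (∀ x b c, dist (V x b) (V x c) ≤ C * dist b c) ∧ ∀ b, (fun x => V x b) =ᵐ[p] w b := by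
  rcases isEmpty_or_nonempty B with hB | hB
  · exact ⟨fun _ b => hB.elim b, fun b => hB.elim b, fun _ b => hB.elim b, fun b => hB.elim b⟩
  set e := TopologicalSpace.denseSeq B
  set G : Set X := {x | ∀ m n, dist (w (e m) x) (w (e n) x) ≤ C * dist (e m) (e n)}
  have hGm : MeasurableSet G := by
    have : G = ⋂ m, ⋂ n, {x | dist (w (e m) x) (w (e n) x) ≤ C * dist (e m) (e n)} := by
      ext x; simp [G]
    rw [this]
    exact MeasurableSet.iInter fun m => MeasurableSet.iInter fun n =>
      measurableSet_le ((hw _).dist (hw _)) measurable_const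
  have hG : ∀ᵐ x ∂p, x ∈ G := ae_all_iff.2 fun m => ae_all_iff.2 fun n => h _ _
  have hk : ∀ b : B, ∃ k : ℕ → ℕ, Tendsto (fun j => e (k j)) atTop (𝓝 b) := fun b => by
    obtain ⟨u, hu, hlim⟩ := mem_closure_iff_seq_limit.1
      (TopologicalSpace.denseRange_denseSeq B b)
    choose k hk using hu
    exact ⟨k, by rwa [(funext hk : (fun j => e (k j)) = u)]⟩
  choose k hk using hk
  set v : ℕ → X → ℂ := fun n => G.indicator (w (e n))
  have hv : ∀ m n x, dist (v m x) (v n x) ≤ |C| * dist (e m) (e n) := fun m n x => by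
    by_cases hx : x ∈ G
    · simp only [v, Set.indicator_of_mem hx]
      exact (hx m n).trans (by gcongr; exact le_abs_self C)
    · simp only [v, Set.indicator_of_notMem hx, dist_self]
      positivity
  have hcauchy : ∀ x b, CauchySeq fun j => v (k b j) x := fun x b => by
    rw [Metric.cauchySeq_iff']
    intro ε hε
    have hpos : 0 < |C| + 1 := by positivity
    obtain ⟨N, hN⟩ := Metric.cauchySeq_iff'.1 (hk b).cauchySeq (ε / (|C| + 1)) (by positivity)
    refine ⟨N, fun n hn => (hv _ _ x).trans_lt ?_⟩
    have h1 : |C| * dist (e (k b n)) (e (k b N)) ≤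
        (|C| + 1) * dist (e (k b n)) (e (k b N)) := by gcongr; linarith
    refine h1.trans_lt ?_
    rw [← lt_div_iff₀' hpos]
    exact hN n hn
  choose V hV using fun x b => cauchySeq_tendsto_of_complete (hcauchy x b)
  refine ⟨V, fun b => ?_, fun x b c => ?_, fun b => ?_⟩
  · exact measurable_of_tendsto_metrizable (fun j => (hw _).indicator hGm)
      (tendsto_pi_nhds.2 fun x => hV x b)
  · by_cases hx : x ∈ G
    · refine le_of_tendsto_of_tendsto ((hV x b).dist (hV x c))
        (((hk b).dist (hk c)).const_mul C) (Eventually.of_forall fun j => ?_)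
      simp only [v, Set.indicator_of_mem hx]
      exact hx _ _
    · have h0 : ∀ b, V x b = 0 := fun b => tendsto_nhds_unique (hV x b) (by
        simp only [v, Set.indicator_of_notMem hx]
        exact tendsto_const_nhds)
      rw [h0, h0, dist_self]
      positivity
  -- For the fixed `b`, countably many further null sets are dropped, so that `w (e (k b j))`
  -- converges to `w b` at the remaining points.
  · filter_upwards [hG, ae_all_iff.2 fun j => h (e (k b j)) b] with x hx hxb
    refine tendsto_nhds_unique (hV x b) ?_
    rw [tendsto_iff_dist_tendsto_zero]
    refine squeeze_zero (fun _ => dist_nonneg) (fun j => ?_)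
      (by simpa using (tendsto_iff_dist_tendsto_zero.1 (hk b)).const_mul C)
    simp only [v, Set.indicator_of_mem hx]
    exact hxb j

end Densities

/-! ### Disintegration of functionals on the tensor product -/

section Disintegration

open MeasureTheory Filter Topology
open scoped ComplexOrder

variable {X : Type*} [MeasurableSpace X] {p : Measure X}
  {𝔅 : Type*} [CStarAlgebra 𝔅] [NormOneClass 𝔅]

theorem star_indicatorBddMeas_mul_self (E : Set X) (hE : MeasurableSet E) :
    star (indicatorBddMeas E hE) * indicatorBddMeas E hE = indicatorBddMeas E hE := by
  classical
  refine bddMeas_ext fun x => ?_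
  change star ((indicatorBddMeas E hE : BoundedFun X ℂ) x) *
    (indicatorBddMeas E hE : BoundedFun X ℂ) x = _
  rw [indicatorBddMeas_apply]
  split_ifs <;> simp

/-- An indicator is a projection, so the argument of `ψ` is itself of the form `star F * F`. -/
theorem nonneg_apply_elemTensor_indicator {ψ : tensorAlgebra X 𝔅 →ₗ[ℂ] ℂ}
    (hψ : ∀ F, 0 ≤ ψ (star F * F)) (E : Set X) (hE : MeasurableSet E) (b : 𝔅) :
    0 ≤ ψ (elemTensor (indicatorBddMeas E hE) (star b * b)) := by
  have := hψ (elemTensor (indicatorBddMeas E hE) b)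
  rwa [star_elemTensor_mul_self, star_indicatorBddMeas_mul_self] at this

theorem norm_apply_elemTensor_indicator_le {ψ : tensorAlgebra X 𝔅 →ₗ[ℂ] ℂ}
    (hψ : ∀ F, 0 ≤ ψ (star F * F)) (E : Set X) (hE : MeasurableSet E) (b : 𝔅) :
    ‖ψ (elemTensor (indicatorBddMeas E hE) b)‖ ≤
      4 * (‖b‖ * ‖ψ (elemTensor (indicatorBddMeas E hE) 1)‖) :=
  norm_apply_le_of_forall_nonneg (φ := ψ ∘ₗ elemTensorRight (indicatorBddMeas E hE))
    (nonneg_apply_elemTensor_indicator hψ E hE) b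

theorem elemTensor_indicator_univ_one :
    elemTensor (indicatorBddMeas (Set.univ : Set X) MeasurableSet.univ) (1 : 𝔅) = 1 := by
  refine tensorAlgebra_ext fun x => ?_
  rw [elemTensor_apply, indicatorBddMeas_apply, if_pos (Set.mem_univ x), one_smul]
  rfl

theorem tensorShift_elemTensor_indicator {τ : X → X} (hτ : Measurable τ) (T : 𝔅 →⋆ₐ[ℂ] 𝔅)
    (E : Set X) (hE : MeasurableSet E) (b : 𝔅) :
    tensorShift hτ T (elemTensor (indicatorBddMeas E hE) b) =
      elemTensor (indicatorBddMeas (τ ⁻¹' E) (hτ hE)) (T b) := by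
  classical
  refine tensorAlgebra_ext fun x => ?_
  change T ((elemTensor (indicatorBddMeas E hE) b).1 (τ x)) = _
  rw [elemTensor_apply, elemTensor_apply, map_smul, indicatorBddMeas_apply, indicatorBddMeas_apply]
  rfl

/-- `V` is a density with respect to `p` of the functional `ψ`, that is,
`ψ (f ⊗ b) = ∫ f(x) V(x, b) p(dx)`. -/
structure IsDensity (p : Measure X) (ψ : tensorAlgebra X 𝔅 →ₗ[ℂ] ℂ) (V : X → 𝔅 → ℂ) : Prop where
  measurable : ∀ b, Measurable fun x => V x b
  integrable : ∀ b, Integrable (fun x => V x b) p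
  continuous : ∀ x, Continuous (V x)
  setIntegral : ∀ b E hE, ∫ x in E, V x b ∂p = ψ (elemTensor (indicatorBddMeas E hE) b)

/-- Radon–Nikodym gives a density for each `b` separately. Applied to `b - c`, the domination bound
makes these densities Lipschitz in `b` almost everywhere, and the modification makes this true at
every point. The constant `8 * K` combines the 4 for positive functionals with the 2 for
complex-valued functions. -/
theorem exists_isDensity [IsFiniteMeasure p] [TopologicalSpace.SeparableSpace 𝔅]
    {ψ : tensorAlgebra X 𝔅 →ₗ[ℂ] ℂ} (hψ : ∀ F, 0 ≤ ψ (star F * F)) {K : ℝ} (hK0 : 0 ≤ K)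
    (hK : ∀ E hE, ‖ψ (elemTensor (indicatorBddMeas E hE) 1)‖ ≤ K * p.real E) :
    ∃ V : X → 𝔅 → ℂ, IsDensity p ψ V := by
  have hbound : ∀ b E hE, ‖ψ (elemTensor (indicatorBddMeas E hE) b)‖ ≤
      4 * K * ‖b‖ * p.real E := fun b E hE =>
    (norm_apply_elemTensor_indicator_le hψ E hE b).trans <| by
      calc 4 * (‖b‖ * ‖ψ (elemTensor (indicatorBddMeas E hE) 1)‖)
          ≤ 4 * (‖b‖ * (K * p.real E)) := by gcongr; exact hK E hE
        _ = 4 * K * ‖b‖ * p.real E := by ring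
  choose w hwm hwi hw using fun b => exists_density (p := p) (ψ ∘ₗ elemTensorLeft b)
    (4 * K * ‖b‖) (hbound b)
  have hlip : ∀ b c, ∀ᵐ x ∂p, dist (w b x) (w c x) ≤ 8 * K * dist b c := fun b c => by
    have := ae_norm_le_of_forall_setIntegral_norm_le (C := 4 * K * ‖b - c‖) ((hwi b).sub (hwi c))
      fun E hE => by
        have h1 : ∫ x in E, (w b - w c) x ∂p =
            ψ (elemTensor (indicatorBddMeas E hE) (b - c)) := by
          simp only [Pi.sub_apply]
          rw [integral_sub (hwi b).restrict (hwi c).restrict, hw b E hE, hw c E hE]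
          exact (map_sub (ψ ∘ₗ elemTensorRight (indicatorBddMeas E hE)) b c).symm
        rw [h1]
        exact hbound _ E hE
    filter_upwards [this] with x hx
    rw [dist_eq_norm, dist_eq_norm]
    refine hx.trans_eq (by ring)
  obtain ⟨V, hVm, hVl, hV⟩ := exists_lipschitz_modification hwm (by positivity) hlip
  refine ⟨V, hVm, fun b => (hwi b).congr (hV b).symm, fun x => ?_, fun b E hE => ?_⟩
  · exact (LipschitzWith.of_dist_le_mul (K := ⟨8 * K, by positivity⟩) (hVl x)).continuous
  · rw [setIntegral_congr_ae hE ((hV b).mono fun x hx _ => hx)]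
    exact hw b E hE

namespace IsDensity

variable {ψ : tensorAlgebra X 𝔅 →ₗ[ℂ] ℂ} {V : X → 𝔅 → ℂ}

/-- Additivity, homogeneity and positivity hold almost everywhere for each choice of arguments,
hence almost everywhere on countable dense sets of elements and scalars at once. Continuity of `V x`
carries them to all arguments. -/
theorem ae_exists_state [IsFiniteMeasure p] [TopologicalSpace.SeparableSpace 𝔅]
    (hV : IsDensity p ψ V) (hψ : ∀ F, 0 ≤ ψ (star F * F)) (h1 : ∀ᵐ x ∂p, V x 1 = 1) :
    ∀ᵐ x ∂p, ∃ φ ∈ states 𝔅, ∀ b, φ b = V x b := by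
  set e := TopologicalSpace.denseSeq 𝔅
  have he : DenseRange e := TopologicalSpace.denseRange_denseSeq 𝔅
  set c := TopologicalSpace.denseSeq ℂ
  have hc : DenseRange c := TopologicalSpace.denseRange_denseSeq ℂ
  have hadd : ∀ b b', (fun x => V x (b + b')) =ᵐ[p] fun x => V x b + V x b' := fun b b' =>
    Integrable.ae_eq_of_forall_setIntegral_eq _ _ (hV.integrable _)
      ((hV.integrable _).add (hV.integrable _)) fun E hE _ => by
        rw [integral_add (hV.integrable _).restrict (hV.integrable _).restrict,
          hV.setIntegral _ E hE, hV.setIntegral _ E hE, hV.setIntegral _ E hE, ← map_add,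
          elemTensor_add_right]
  have hsmul : ∀ (r : ℂ) b, (fun x => V x (r • b)) =ᵐ[p] fun x => r * V x b := fun r b =>
    Integrable.ae_eq_of_forall_setIntegral_eq _ _ (hV.integrable _)
      ((hV.integrable _).const_mul _) fun E hE _ => by
        rw [integral_const_mul, hV.setIntegral _ E hE, hV.setIntegral _ E hE,
          elemTensor_smul_right, map_smul, smul_eq_mul]
  have hpos : ∀ b, ∀ᵐ x ∂p, 0 ≤ V x (star b * b) := fun b =>
    ae_nonneg_of_forall_setIntegral_nonneg' (hV.integrable _) fun E hE => by
      rw [hV.setIntegral _ E hE]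
      exact nonneg_apply_elemTensor_indicator hψ E hE b
  filter_upwards [h1, ae_all_iff.2 fun m => ae_all_iff.2 fun n => hadd (e m) (e n),
    ae_all_iff.2 fun m => ae_all_iff.2 fun n => hsmul (c m) (e n),
    ae_all_iff.2 fun n => hpos (e n)] with x hx1 hxadd hxsmul hxpos
  have hVc := hV.continuous x
  refine ⟨⟨⟨V x, fun b b' => ?_⟩, fun r b => ?_⟩, ⟨fun b => ?_, hx1⟩, fun b => rfl⟩
  · exact he.induction_on₂ (p := fun b b' => V x (b + b') = V x b + V x b')
      (isClosed_eq (by fun_prop) (by fun_prop)) hxadd b b'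
  · change V x (r • b) = r * V x b
    refine he.induction_on (p := fun b => V x (r • b) = r * V x b) b
      (isClosed_eq (by fun_prop) (by fun_prop)) fun n => ?_
    exact hc.induction_on (p := fun r => V x (r • e n) = r * V x (e n)) r
      (isClosed_eq (by fun_prop) (by fun_prop)) fun m => hxsmul m n
  · exact he.induction_on (p := fun b => 0 ≤ V x (star b * b)) b
      (isClosed_le continuous_const (by fun_prop)) hxpos

theorem ae_apply_equiv [IsFiniteMeasure p] [TopologicalSpace.SeparableSpace 𝔅]
    (hV : IsDensity p ψ V) {τ : X ≃ᵐ X} (hτ : MeasurePreserving τ p p) (T : 𝔅 →⋆ₐ[ℂ] 𝔅)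
    (hψ : ∀ F, ψ (tensorShift τ.measurable T F) = ψ F) :
    ∀ᵐ x ∂p, ∀ b, V (τ x) b = V x (T b) := by
  have h : ∀ b, (fun x => V (τ x) b) =ᵐ[p] fun x => V x (T b) := fun b =>
    Integrable.ae_eq_of_forall_setIntegral_eq _ _
      ((hτ.integrable_comp_emb τ.measurableEmbedding).2 (hV.integrable b)) (hV.integrable _)
      fun E hE _ => by
        -- Invertibility of `τ` is used here: every test set is a preimage, so invariance of `p` and
        -- of `ψ` compares both integrals with the same value of `ψ`.
        obtain ⟨F, hF, rfl⟩ : ∃ F, MeasurableSet F ∧ τ ⁻¹' F = E :=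
          ⟨τ.symm ⁻¹' E, τ.symm.measurable hE, by rw [← Set.preimage_comp]; simp⟩
        rw [hτ.setIntegral_preimage_emb τ.measurableEmbedding (fun x => V x b),
          hV.setIntegral _ F hF, hV.setIntegral _ _ hE, ← hψ, tensorShift_elemTensor_indicator]
  have hT : Continuous T := AddMonoidHomClass.continuous_of_bound T 1 fun b => by
    simpa using NonUnitalStarAlgHom.norm_apply_le T b
  filter_upwards [ae_all_iff.2 fun n => h (TopologicalSpace.denseSeq 𝔅 n)] with x hx b
  exact (TopologicalSpace.denseRange_denseSeq 𝔅).induction_on (p := fun b => V (τ x) b = V x (T b))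
    b (isClosed_eq (hV.continuous _) ((hV.continuous x).comp hT)) hx

/-- Since `T` fixes the unit, `x ↦ V x 1` is invariant and so almost everywhere constant by
ergodicity; its integral is `ψ 1`. This is where the construction of channels from densities needs
more than stationarity of `p`. -/
theorem ae_apply_one [IsProbabilityMeasure p] [TopologicalSpace.SeparableSpace 𝔅]
    (hV : IsDensity p ψ V) {τ : X ≃ᵐ X} (hτ : Ergodic τ p) (T : 𝔅 →⋆ₐ[ℂ] 𝔅)
    (hψ : ψ ∈ stationaryStates (tensorShift τ.measurable T)) : ∀ᵐ x ∂p, V x 1 = 1 := by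
  obtain ⟨c, hc⟩ := hτ.ae_eq_const_of_ae_eq_comp_ae (hV.measurable 1).aestronglyMeasurable <| by
    filter_upwards [hV.ae_apply_equiv hτ.toMeasurePreserving T hψ.2] with x hx
    rw [Function.comp_apply, hx 1, map_one]
  have h1 : ∫ x, V x 1 ∂p = 1 := by
    rw [← setIntegral_univ, hV.setIntegral 1 _ MeasurableSet.univ, elemTensor_indicator_univ_one,
      hψ.1.2]
  rw [integral_congr_ae hc] at h1
  filter_upwards [hc] with x hx
  rw [hx, ← h1]
  simp

/-- Densities are unique almost everywhere. -/
theorem ae_eq [IsFiniteMeasure p] [TopologicalSpace.SeparableSpace 𝔅] {V' : X → 𝔅 → ℂ}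
    (hV : IsDensity p ψ V) (hV' : IsDensity p ψ V') : ∀ᵐ x ∂p, V x = V' x := by
  have h : ∀ b, (fun x => V x b) =ᵐ[p] fun x => V' x b := fun b =>
    Integrable.ae_eq_of_forall_setIntegral_eq _ _ (hV.integrable _) (hV'.integrable _)
      fun E hE _ => by rw [hV.setIntegral _ E hE, hV'.setIntegral _ E hE]
  filter_upwards [ae_all_iff.2 fun n => h (TopologicalSpace.denseSeq 𝔅 n)] with x hx
  exact (TopologicalSpace.denseRange_denseSeq 𝔅).equalizer (hV.continuous x) (hV'.continuous x)
    (funext hx)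

theorem linearCombination {ψ₁ ψ₂ : tensorAlgebra X 𝔅 →ₗ[ℂ] ℂ} {V₁ V₂ : X → 𝔅 → ℂ}
    (h₁ : IsDensity p ψ₁ V₁) (h₂ : IsDensity p ψ₂ V₂) (a b : ℂ) :
    IsDensity p (a • ψ₁ + b • ψ₂) fun x => a • V₁ x + b • V₂ x where
  measurable c := ((h₁.measurable c).const_mul a).add ((h₂.measurable c).const_mul b)
  integrable c := ((h₁.integrable c).const_mul a).add ((h₂.integrable c).const_mul b)
  continuous x := ((h₁.continuous x).const_smul a).add ((h₂.continuous x).const_smul b)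
  setIntegral c E hE := by
    change ∫ x in E, a * V₁ x c + b * V₂ x c ∂p = a * ψ₁ _ + b * ψ₂ _
    rw [integral_add ((h₁.integrable c).const_mul a).restrict
      ((h₂.integrable c).const_mul b).restrict, integral_const_mul, integral_const_mul,
      h₁.setIntegral c E hE, h₂.setIntegral c E hE]

end IsDensity

/-- An almost sure event contains an invariant almost sure event. -/
theorem exists_invariant_measurableSet_subset {τ : X ≃ᵐ X} (hτ : MeasurePreserving τ p p)
    {P : X → Prop} (hP : ∀ᵐ x ∂p, P x) :
    ∃ S : Set X, MeasurableSet S ∧ (∀ x, τ x ∈ S ↔ x ∈ S) ∧ (∀ x ∈ S, P x) ∧ ∀ᵐ x ∂p, x ∈ S := by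
  obtain ⟨t, hPt, ht, hpt⟩ := exists_measurable_superset_of_null (ae_iff.1 hP)
  have htc : ∀ᵐ x ∂p, x ∉ t := measure_eq_zero_iff_ae_notMem.1 hpt
  have hτ' : MeasurePreserving τ.symm p p := hτ.symm
  -- The points whose whole two-sided orbit avoids the null set `t`; using both directions makes the
  -- set invariant in the sense of an equivalence.
  refine ⟨{x | ∀ n : ℕ, τ^[n] x ∉ t ∧ τ.symm^[n] x ∉ t}, ?_, fun x => ⟨fun h n => ?_, fun h n => ?_⟩,
    fun x hx => by_contra fun hPx => (hx 0).1 (hPt hPx), ae_all_iff.2 fun n => ?_⟩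
  · have : {x | ∀ n : ℕ, τ^[n] x ∉ t ∧ τ.symm^[n] x ∉ t} =
        ⋂ n : ℕ, (τ^[n] ⁻¹' tᶜ ∩ τ.symm^[n] ⁻¹' tᶜ) := by
      ext x; simp
    rw [this]
    exact MeasurableSet.iInter fun n => ((τ.measurable.iterate n) ht.compl).inter
      ((τ.symm.measurable.iterate n) ht.compl)
  · refine ⟨?_, by simpa using (h (n + 1)).2⟩
    -- The zeroth forward iterate of `x` is not a forward iterate of `τ x`; it is the first backward
    -- one.
    cases n with
    | zero => simpa using (h 1).2
    | succ n => exact (h n).1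
  · refine ⟨(h (n + 1)).1, ?_⟩
    cases n with
    | zero => exact (h 1).1
    | succ n => simpa using (h n).2
  · exact ((hτ.iterate n).quasiMeasurePreserving.ae htc).and
      ((hτ'.iterate n).quasiMeasurePreserving.ae htc)

end Disintegration

/-! ### Extremal and ergodic channels -/

section Channels

open MeasureTheory Filter Topology

/-- The left shift as a measurable equivalence. -/
def shiftInEquiv (A : Type*) [MeasurableSpace A] : (ℤ → A) ≃ᵐ (ℤ → A) where
  toFun := shiftIn A
  invFun x n := x (n - 1)
  left_inv x := by ext n; simp [shiftIn]
  right_inv x := by ext n; simp [shiftIn]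
  measurable_toFun := measurable_shiftIn A
  measurable_invFun := measurable_pi_lambda _ fun n => measurable_pi_apply (n - 1)

/-- With the discrete topology on the finite alphabet, the sequence space is compact and metrizable,
its Borel sets are generated by cylinders, and the shift is continuous. -/
theorem exists_ergodic_measure_pos_shiftIn {A : Type*} [Finite A] [MeasurableSpace A]
    [DiscreteMeasurableSpace A] {p : Measure (ℤ → A)} [IsProbabilityMeasure p]
    (hp : MeasurePreserving (shiftIn A) p p) {N : Set (ℤ → A)} (hN : MeasurableSet N)
    (hpN : 0 < p N) :
    ∃ q : Measure (ℤ → A), IsProbabilityMeasure q ∧ Ergodic (shiftIn A) q ∧ 0 < q N := by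
  let : TopologicalSpace A := ⊥
  have : DiscreteTopology A := ⟨rfl⟩
  exact exists_ergodic_measure_pos (continuous_pi fun n => continuous_apply (n + 1)) hp hN hpN

namespace CQChannel

variable {A : Type*} [MeasurableSpace A] {d : ℕ} [NeZero d]

/-- Combined with uniqueness of densities, this recovers a channel `p`-almost everywhere from its
joint state. -/
theorem isDensity_jointState (p : Measure (ℤ → A)) [IsProbabilityMeasure p] (W : CQChannel A d) :
    IsDensity p (jointState p W) fun x => W.toFun x where
  measurable := W.measurable_toFun
  integrable b := Integrable.of_bound (W.measurable_toFun b).aestronglyMeasurable (4 * ‖b‖) <|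
    Eventually.of_forall fun x => norm_state_le (W.toFun_mem_states x) b
  continuous x := continuous_of_mem_states (W.toFun_mem_states x)
  setIntegral b E hE := by
    classical
    rw [jointState_elemTensor, ← integral_indicator hE]
    refine integral_congr_ae (Eventually.of_forall fun x => ?_)
    change E.indicator (fun x => W.toFun x b) x =
      (indicatorBddMeas E hE : BoundedFun (ℤ → A) ℂ) x * W.toFun x b
    rw [indicatorBddMeas_apply, Set.indicator_apply]
    split_ifs <;> simp

open scoped ComplexOrder in
theorem jointState_mem_stationaryStates {p : Measure (ℤ → A)} [IsProbabilityMeasure p]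
    (hp : MeasurePreserving (shiftIn A) p p) {W : CQChannel A d} (hW : W.IsStationary) :
    jointState p W ∈ stationaryStates (jointShift A d) := by
  refine ⟨⟨fun F => integral_nonneg fun x => (W.toFun_mem_states x).1 (F.1 x), ?_⟩, fun F => ?_⟩
  · change ∫ x, W.toFun x 1 ∂p = 1
    simp [(W.toFun_mem_states _).2]
  · change ∫ x, W.toFun x (QuasiLocal.shift d (F.1 (shiftIn A x))) ∂p = ∫ x, W.toFun x (F.1 x) ∂p
    simp only [← hW _ _]
    exact MeasurePreserving.integral_comp (f := shiftIn A) hp (shiftInEquiv A).measurableEmbedding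
      fun x => W.toFun x (F.1 x)

theorem jointState_convexComb (p : Measure (ℤ → A)) [IsProbabilityMeasure p] {a : ℝ}
    (ha : a ∈ Set.Ioo (0 : ℝ) 1) (W₁ W₂ : CQChannel A d) :
    jointState p (convexComb a ha W₁ W₂) = a • jointState p W₁ + (1 - a) • jointState p W₂ := by
  ext F
  change ∫ x, ((a : ℂ) * W₁.toFun x (F.1 x) + ((1 - a : ℝ) : ℂ) * W₂.toFun x (F.1 x)) ∂p =
    a • jointState p W₁ F + (1 - a) • jointState p W₂ F
  rw [integral_add ((W₁.integrable_apply F p).const_mul _) ((W₂.integrable_apply F p).const_mul _),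
    integral_const_mul, integral_const_mul, Complex.real_smul, Complex.real_smul]
  rfl

theorem continuous_jointState (p : Measure (ℤ → A)) [IsProbabilityMeasure p] (W : CQChannel A d) :
    Continuous (jointState p W) :=
  AddMonoidHomClass.continuous_of_bound (jointState p W) 4 fun F => by
    refine (norm_integral_le_of_norm_le_const (C := 4 * ‖F‖) <| Eventually.of_forall fun x =>
      (norm_state_le (W.toFun_mem_states x) _).trans ?_).trans_eq (by simp)
    gcongr
    exact lp.norm_apply_le_norm ENNReal.top_ne_zero F.1 x

theorem StationaryEq.jointState_eq {W₁ W₂ : CQChannel A d} (h : StationaryEq W₁ W₂)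
    {p : Measure (ℤ → A)} [IsProbabilityMeasure p] (hp : MeasurePreserving (shiftIn A) p p) :
    jointState p W₁ = jointState p W₂ :=
  eq_of_forall_elemTensor (continuous_jointState p W₁) (continuous_jointState p W₂) (h p hp)

/-- If a stationary measure charged the set where the channels differ at `b`, an ergodic one would
charge it as well, although equal joint states force the channels to agree almost everywhere for
that measure. -/
theorem stationaryEq_of_forall_ergodic [Finite A] [DiscreteMeasurableSpace A]
    {W₁ W₂ : CQChannel A d} (h : ∀ (p : Measure (ℤ → A)) [IsProbabilityMeasure p],
      Ergodic (shiftIn A) p → jointState p W₁ = jointState p W₂) : StationaryEq W₁ W₂ := by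
  intro p _ hp f b
  rw [jointState_elemTensor, jointState_elemTensor]
  suffices h0 : p {x | W₁.toFun x b ≠ W₂.toFun x b} = 0 by
    refine integral_congr_ae ?_
    filter_upwards [measure_eq_zero_iff_ae_notMem.1 h0] with x hx
    rw [not_not.1 hx]
  by_contra hne
  have hN : MeasurableSet {x | W₁.toFun x b ≠ W₂.toFun x b} :=
    (measurableSet_eq_fun (W₁.measurable_toFun b) (W₂.measurable_toFun b)).compl
  obtain ⟨q, hq, hqe, hqN⟩ := exists_ergodic_measure_pos_shiftIn hp hN (pos_iff_ne_zero.2 hne)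
  have h₁ := isDensity_jointState q W₁
  rw [h q hqe] at h₁
  refine hqN.ne' (measure_eq_zero_iff_ae_notMem.2 ?_)
  filter_upwards [h₁.ae_eq (isDensity_jointState q W₂)] with x hx hx'
  exact hx' (congrFun hx b)

theorem IsErgodic.isExtremal [Finite A] [DiscreteMeasurableSpace A] {W : CQChannel A d}
    (hW : W.IsErgodic) : W.IsExtremal := by
  refine ⟨hW.1, fun W₁ W₂ h₁ h₂ a ha h => stationaryEq_of_forall_ergodic fun p _ hp => ?_⟩
  have hext := (mem_extremePoints_iff_left.1 (hW.2 p hp)).2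
  have hmem₁ := jointState_mem_stationaryStates hp.toMeasurePreserving h₁
  have hmem₂ := jointState_mem_stationaryStates hp.toMeasurePreserving h₂
  have hseg : jointState p W ∈ openSegment ℝ (jointState p W₁) (jointState p W₂) :=
    ⟨a, 1 - a, ha.1, sub_pos.2 ha.2, by ring,
      by rw [h.jointState_eq hp.toMeasurePreserving, jointState_convexComb]⟩
  rw [hext _ hmem₁ _ hmem₂ hseg]
  -- The one-sided criterion for extreme points identifies only the left endpoint, so it is applied
  -- again with the endpoints exchanged.
  rw [openSegment_symm] at hseg
  exact (hext _ hmem₂ _ hmem₁ hseg).symm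

/-- A stationary channel may be replaced on an invariant set by a stationary family of states. -/
theorem exists_eqOn {W : CQChannel A d} (hW : W.IsStationary) {S : Set (ℤ → A)}
    (hS : MeasurableSet S) (hSi : ∀ x, shiftIn A x ∈ S ↔ x ∈ S) {V : (ℤ → A) → QuasiLocal d → ℂ}
    (hVm : ∀ b, Measurable fun x => V x b)
    (hVs : ∀ x ∈ S, ∃ φ ∈ states (QuasiLocal d), ∀ b, φ b = V x b)
    (hVi : ∀ x ∈ S, ∀ b, V (shiftIn A x) b = V x (QuasiLocal.shift d b)) :
    ∃ W' : CQChannel A d, W'.IsStationary ∧ (∀ x ∈ S, ∀ b, W'.toFun x b = V x b) ∧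
      ∀ x ∉ S, W'.toFun x = W.toFun x := by
  classical
  choose! φ hφ hφV using hVs
  refine ⟨⟨fun x => if x ∈ S then φ x else W.toFun x, fun b => ?_, fun x => ?_⟩,
    fun x b => ?_, fun x hx b => ?_, fun x hx => ?_⟩
  · have : (fun x => (if x ∈ S then φ x else W.toFun x) b) =
        fun x => if x ∈ S then V x b else W.toFun x b := by
      ext x
      split_ifs with hx
      · exact hφV x hx b
      · rfl
    rw [this]
    exact Measurable.ite hS (hVm b) (W.measurable_toFun b)
  · split_ifs with hx
    · exact hφ x hx
    · exact W.toFun_mem_states x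
  · by_cases hx : x ∈ S
    · simp only [if_pos hx, if_pos ((hSi x).2 hx)]
      rw [hφV _ ((hSi x).2 hx), hφV x hx, hVi x hx]
    · simp only [if_neg hx, if_neg (mt (hSi x).1 hx)]
      exact hW x b
  · simp only [if_pos hx]
    exact hφV x hx b
  · simp only [if_neg hx]

open scoped ComplexOrder in
-- On positive elements `a • ψ₁` is at most the joint state, whose value at `1_E ⊗ 1` is `p E`. So
-- `ψ₁` is dominated with constant `a⁻¹`.
theorem exists_isDensity_of_add_eq_jointState {p : Measure (ℤ → A)} [IsProbabilityMeasure p]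
    {W : CQChannel A d} {ψ₁ ψ₂ : JointAlgebra A d →ₗ[ℂ] ℂ} (h₁ : ψ₁ ∈ states (JointAlgebra A d))
    (h₂ : ψ₂ ∈ states (JointAlgebra A d)) {a b : ℝ} (ha : 0 < a) (hb : 0 ≤ b)
    (h : a • ψ₁ + b • ψ₂ = jointState p W) :
    ∃ V : (ℤ → A) → QuasiLocal d → ℂ, IsDensity p ψ₁ V := by
  refine exists_isDensity h₁.1 (inv_nonneg.2 ha.le) fun E hE => ?_
  set F := elemTensor (indicatorBddMeas E hE) (1 : QuasiLocal d) with hF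
  have hW : jointState p W F = p.real E := by
    rw [hF, ← (isDensity_jointState p W).setIntegral 1 E hE]
    simp [(W.toFun_mem_states _).2]
  have hF₁ : 0 ≤ ψ₁ F := by simpa using nonneg_apply_elemTensor_indicator h₁.1 E hE 1
  have hF₂ : 0 ≤ ψ₂ F := by simpa using nonneg_apply_elemTensor_indicator h₂.1 E hE 1
  have hsum : a * ψ₁ F + b * ψ₂ F = p.real E := by
    rw [← hW, ← h]
    rfl
  have hre := congrArg Complex.re hsum
  rw [Complex.add_re, Complex.re_ofReal_mul, Complex.re_ofReal_mul, Complex.ofReal_re] at hre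
  rw [Complex.nonneg_iff] at hF₁ hF₂
  rw [← Complex.abs_re_eq_norm.2 hF₁.2.symm, abs_of_nonneg hF₁.1, ← div_eq_inv_mul,
    le_div_iff₀' ha]
  linarith [mul_nonneg hb hF₂.1]

theorem IsExtremal.isErgodic {W : CQChannel A d} (hW : W.IsExtremal) : W.IsErgodic := by
  refine ⟨hW.1, fun p _ hp => mem_extremePoints_iff_left.2
    ⟨jointState_mem_stationaryStates hp.toMeasurePreserving hW.1, ?_⟩⟩
  rintro ψ₁ h₁ ψ₂ h₂ ⟨a, b, ha, hb, hab, h⟩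
  have hp' : Ergodic (shiftInEquiv A) p := hp
  obtain ⟨V₁, hV₁⟩ := exists_isDensity_of_add_eq_jointState h₁.1 h₂.1 ha hb.le h
  obtain ⟨V₂, hV₂⟩ := exists_isDensity_of_add_eq_jointState h₂.1 h₁.1 hb ha.le
    ((add_comm _ _).trans h)
  have hWV : ∀ᵐ x ∂p, (a : ℂ) • V₁ x + (b : ℂ) • V₂ x = W.toFun x :=
    (hV₁.linearCombination hV₂ a b).ae_eq (h ▸ isDensity_jointState p W)
  have hst₁ := hV₁.ae_exists_state h₁.1.1 (hV₁.ae_apply_one hp' _ h₁)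
  have hst₂ := hV₂.ae_exists_state h₂.1.1 (hV₂.ae_apply_one hp' _ h₂)
  have hsh₁ := hV₁.ae_apply_equiv hp'.toMeasurePreserving _ h₁.2
  have hsh₂ := hV₂.ae_apply_equiv hp'.toMeasurePreserving _ h₂.2
  -- All almost sure properties are collected on one invariant set, so that the densities can
  -- replace `W` there without breaking stationarity.
  obtain ⟨S, hS, hSi, hSP, hpS⟩ := exists_invariant_measurableSet_subset hp'.toMeasurePreserving
    (hWV.and ((hst₁.and hsh₁).and (hst₂.and hsh₂)))
  obtain ⟨W₁, hW₁, hWV₁, hWS₁⟩ := exists_eqOn hW.1 hS hSi hV₁.measurable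
    (fun x hx => (hSP x hx).2.1.1) fun x hx => (hSP x hx).2.1.2
  obtain ⟨W₂, hW₂, hWV₂, hWS₂⟩ := exists_eqOn hW.1 hS hSi hV₂.measurable
    (fun x hx => (hSP x hx).2.2.1) fun x hx => (hSP x hx).2.2.2
  have ha1 : a ∈ Set.Ioo (0 : ℝ) 1 := ⟨ha, by linarith⟩
  have hb1 : 1 - a = b := by linarith
  -- Equality is needed at every point and not just `p`-almost everywhere, because extremality
  -- compares joint states for all stationary inputs. Off `S` it holds since both channels equal `W`
  -- there.
  have hcomb : ∀ x c, (convexComb a ha1 W₁ W₂).toFun x c = W.toFun x c := fun x c => by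
    change (a : ℂ) * W₁.toFun x c + ((1 - a : ℝ) : ℂ) * W₂.toFun x c = _
    by_cases hx : x ∈ S
    · rw [hWV₁ x hx, hWV₂ x hx, hb1]
      exact congrFun (hSP x hx).1 c
    · rw [hWS₁ x hx, hWS₂ x hx, ← add_mul, ← Complex.ofReal_add]
      simp
  have hEq : StationaryEq W₁ W₂ := hW.2 W₁ W₂ hW₁ hW₂ a ha1 fun q _ _ f c => by
    rw [jointState_elemTensor, jointState_elemTensor]
    simp only [hcomb]
  -- Changing a density outside `S` does not affect integrals against `p`, so each `ψ` is the joint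
  -- state of the channel built from it.
  have hψ : ∀ {W' : CQChannel A d} {V : (ℤ → A) → QuasiLocal d → ℂ}
      {ψ : JointAlgebra A d →ₗ[ℂ] ℂ}, IsDensity p ψ V → ψ ∈ stationaryStates (jointShift A d) →
      (∀ x ∈ S, ∀ b, W'.toFun x b = V x b) → ψ = jointState p W' := by
    intro W' V ψ hV hψ hWV'
    refine eq_of_forall_elemTensor_indicator (continuous_of_mem_states hψ.1)
      (continuous_jointState p W') fun E hE c => ?_
    rw [← hV.setIntegral c E hE, ← (isDensity_jointState p W').setIntegral c E hE]
    refine setIntegral_congr_ae hE ?_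
    filter_upwards [hpS] with x hx _
    exact (hWV' x hx c).symm
  have hψ₁₂ : ψ₁ = ψ₂ := by
    rw [hψ hV₁ h₁ hWV₁, hψ hV₂ h₂ hWV₂, hEq.jointState_eq hp.toMeasurePreserving]
  rw [← h, ← hψ₁₂, ← add_smul, hab, one_smul]

end CQChannel

end Channels

end CQ

end

theorem mainTheorem5 {A : Type*} [Finite A] [MeasurableSpace A] [DiscreteMeasurableSpace A]
    {d : ℕ} [NeZero d] (W : CQ.CQChannel A d) (hW : W.IsStationary) :
    W.IsExtremal ↔ W.IsErgodic :=
  ⟨fun h => h.isErgodic, fun h => h.isExtremal⟩
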